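/- **Conventions.** A graph on a topological space $X$ is a symmetric irreflexive relation $G$ on $X$. Its continuous chromatic number (CCN) $\chi_c(X,G)$ is the least cardinal $\kappa\le\aleph_0$ such that there is a continuous map $c:X\to\kappa$ ($\kappa$ discrete) with $c(x)\ne c(y)$ whenever $(x,y)\in G$, and it is $2^{\aleph_0}$ if there is no such $\kappa$. We write $(X,G)\preceq^i_c(Y,H)$ if there is an injective continuous map $\varphi:X\to Y$ such that $(x,y)\in G$ implies $(\varphi(x),\varphi(y))\in H$. For $f:X\to X$, the graph induced by $f$ is $G_f=\{(x,y)\in X^2\mid x\ne y\text{ and }(f(x)=y\text{ or }f(y)=x)\}$. A 0DMC space is a zero-dimensional metrizable compact space. $\mathfrak G_2$ is the class of graphs induced by a homeomorphism of a 0DMC space onto itself, with CCN strictly bigger than $2$. An element $x$ of a quasi-ordered class $\Gamma$ is minimal in $\Gamma$ if $y\in\Gamma$ and $y\le x$ imply $x\le y$. A basis for $\Gamma$ is a subclass $\mathfrak B\subseteq\Gamma$ such that every element of $\Gamma$ is above an element of $\mathfrak B$. A two-sided subshift is a closed set $\Sigma\subseteq A^{\mathbb Z}$, where $A$ is a finite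 discrete set with at least two elements, such that $\sigma[\Sigma]=\Sigma$, where $\sigma(\alpha)(k)=\alpha(k+1)$. The Cantor–Bendixson rank of a nonempty countable metrizable compact space $X$ is the least ordinal $\alpha$ such that $X^{\alpha}=\emptyset$, where $X^0=X$, $X^{\alpha+1}$ is the set of limit points of the space $X^\alpha$, and $X^\lambda=\bigcap_{\alpha<\lambda}X^\alpha$ for limit $\lambda$. **Theorem.** (a) Let $\xi\ge 1$ be a countable ordinal which is finite or of the form $\eta+3$. Then there is a countable two-sided subshift $\Sigma$ with Cantor–Bendixson rank $\xi$ such that $(\Sigma,G_{\sigma|_\Sigma})$ has CCN three, and is $\preceq^i_c$-minimal in $\mathfrak G_2$ and in the class of closed graphs on a 0DMC space with CCN at least three (in particular, it belongs to both classes). (b) There is a family $(\Sigma_\alpha)_{\alpha\in 2^\omega}$ of countable two-sided subshifts with Cantor–Bendixson rank three such that each $(\Sigma_\alpha,G_{\sigma|_{\Sigma_\alpha}})$ has CCN three and is $\preceq^i_c$-minimal in $\mathfrak G_2$ and in the class of closed graphs on a 0DMC space with CCN at least three, and such that $(\Sigma_\alpha,G_{\sigma|_{\Sigma_\alpha}})\not\preceq^i_c(\Sigma_\beta,G_{\sigma|_{\Sigma_\beta}})$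 whenever $\alpha\ne\beta$. In particular, let $\mathfrak B$ be a $\preceq^i_c$-basis for $\mathfrak G_2$, or for the class of graphs induced by a homeomorphism of a countable metrizable compact space with CCN at least three. Then $\mathfrak B$ has at least $2^{\aleph_0}$ elements, and exactly $2^{\aleph_0}$ elements up to isomorphism (two graphs on topological spaces being isomorphic if some homeomorphism between the spaces preserves edges and non-edges). -/

import Mathlib

open Cardinal

/-- A graph on a topological space: the vertices form a space and the edge relation is symmetric
and irreflexive. -/
structure TopGraph where
  V : Type
  [top : TopologicalSpace V]
  graph : SimpleGraph V

attribute [instance] TopGraph.top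

namespace TopGraph

/-- The quasi-order on graphs given by injective continuous homomorphisms. -/
instance : Preorder TopGraph where
  le X Y := ∃ φ : X.V → Y.V, Continuous φ ∧ Function.Injective φ ∧
    ∀ x y, X.graph.Adj x y → Y.graph.Adj (φ x) (φ y)
  le_refl _ := ⟨id, continuous_id, Function.injective_id, fun _ _ h => h⟩
  le_trans _ _ _ := fun ⟨φ, hφ, iφ, eφ⟩ ⟨ψ, hψ, iψ, eψ⟩ =>
    ⟨ψ ∘ φ, hψ.comp hφ, iψ.comp iφ, fun _ _ h => eψ _ _ (eφ _ _ h)⟩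

/-- Isomorphism of graphs on topological spaces: a homeomorphism which preserves edges and
non-edges. -/
def isoSetoid : Setoid TopGraph where
  r X Y := ∃ e : X.V ≃ₜ Y.V, ∀ x y, X.graph.Adj x y ↔ Y.graph.Adj (e x) (e y)
  iseqv :=
    { refl := fun X => ⟨Homeomorph.refl X.V, fun _ _ => Iff.rfl⟩
      symm := fun ⟨e, he⟩ => ⟨e.symm, fun x y => by simp [he]⟩
      trans := fun ⟨e, he⟩ ⟨f, hf⟩ =>
        ⟨e.trans f, fun x y => (he x y).trans (hf (e x) (e y))⟩ }

/-- The continuous chromatic number: the least cardinal `κ ≤ ℵ₀` such that the graph has a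
continuous coloring in a discrete space with `κ` elements (a map to a discrete space is continuous
iff it is locally constant), and the continuum if there is no such `κ`. -/
noncomputable def ccn (X : TopGraph) : Cardinal.{0} :=
  sInf (insert 𝔠 {κ : Cardinal.{0} | κ ≤ ℵ₀ ∧ ∃ (C : Type) (c : X.V → C),
    #C = κ ∧ IsLocallyConstant c ∧ ∀ x y, X.graph.Adj x y → c x ≠ c y})

end TopGraph

/-- The graph induced by a function `f`: distinct points `x`, `y` are joined when `f x = y` or
`f y = x`. -/
def inducedGraph {X : Type} (f : X → X) : SimpleGraph X :=
  SimpleGraph.fromRel fun x y => f x = y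

/-- Zero-dimensional metrizable compact spaces. -/
structure IsZeroDimMetrizableCompact (X : Type) [TopologicalSpace X] : Prop where
  compact : CompactSpace X
  metrizable : TopologicalSpace.MetrizableSpace X
  zeroDim : TopologicalSpace.IsTopologicalBasis {U : Set X | IsClopen U}

/-- The class of graphs induced by a homeomorphism of a zero-dimensional metrizable compact space,
with continuous chromatic number strictly bigger than `κ`. -/
def homeoGraphs (κ : Cardinal.{0}) : Set TopGraph :=
  {X | IsZeroDimMetrizableCompact X.V ∧ (∃ f : X.V ≃ₜ X.V, X.graph = inducedGraph f) ∧ κ < X.ccn}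

/-- The class of closed graphs on a zero-dimensional metrizable compact space, with continuous
chromatic number at least three. -/
def closedGraphs : Set TopGraph :=
  {X | IsZeroDimMetrizableCompact X.V ∧ IsClosed {p : X.V × X.V | X.graph.Adj p.1 p.2} ∧
    3 ≤ X.ccn}

/-- The class of graphs induced by a homeomorphism of a countable metrizable compact space, with
continuous chromatic number at least three. -/
def countableHomeoGraphs : Set TopGraph :=
  {X | Countable X.V ∧ CompactSpace X.V ∧ TopologicalSpace.MetrizableSpace X.V ∧
    (∃ f : X.V ≃ₜ X.V, X.graph = inducedGraph f) ∧ 3 ≤ X.ccn}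

/-- `B` is a basis for the class `Γ`: it is a subclass of `Γ`, and every element of `Γ` is above
an element of `B`. -/
def IsGraphBasis (B Γ : Set TopGraph) : Prop :=
  B ⊆ Γ ∧ ∀ X ∈ Γ, ∃ Y ∈ B, Y ≤ X

/-- The shift map on biinfinite sequences. -/
def shiftMap {A : Type} (x : ℤ → A) : ℤ → A := fun k => x (k + 1)

/-- A two-sided subshift: a closed set of biinfinite sequences over an alphabet (a finite set with
at least two elements, with the discrete topology), equal to its image under the shift map. -/
structure TwoSidedSubshift where
  Alphabet : Type
  [finite : Finite Alphabet]
  [nontrivial : Nontrivial Alphabet]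
  [top : TopologicalSpace Alphabet]
  [discrete : DiscreteTopology Alphabet]
  carrier : Set (ℤ → Alphabet)
  isClosed : IsClosed carrier
  image_shift : shiftMap '' carrier = carrier

attribute [instance] TwoSidedSubshift.top

namespace TwoSidedSubshift

/-- The restriction of the shift map to a subshift. -/
def shift (S : TwoSidedSubshift) (x : S.carrier) : S.carrier :=
  ⟨shiftMap x.1, S.image_shift.subset (Set.mem_image_of_mem shiftMap x.2)⟩

/-- The graph induced by the restriction of the shift map, on the subshift with the subspace
topology. -/
def shiftGraph (S : TwoSidedSubshift) : TopGraph where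
  V := S.carrier
  graph := inducedGraph S.shift

/-- `ξ` is the Cantor-Bendixson rank of the space `S`: the least ordinal for which the iterated
Cantor-Bendixson derivative is empty. -/
def HasCantorBendixsonRank (S : TwoSidedSubshift) (ξ : Ordinal.{0}) : Prop :=
  IsLeast {a : Ordinal.{0} |
    CantorBendixson.iteratedDerivedSet (Set.univ : Set S.carrier) a = ∅} ξ

/-- A countable subshift of Cantor-Bendixson rank `ξ` whose shift graph has continuous chromatic
number three and is minimal, both among graphs induced by a homeomorphism and among closed graphs
(with continuous chromatic number at least three, on zero-dimensional metrizable compact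
spaces). -/
structure IsMinimalExample (S : TwoSidedSubshift) (ξ : Ordinal.{0}) : Prop where
  countable : S.carrier.Countable
  rank : S.HasCantorBendixsonRank ξ
  ccn_eq : S.shiftGraph.ccn = 3
  minimal_homeo : Minimal (· ∈ homeoGraphs 2) S.shiftGraph
  minimal_closed : Minimal (· ∈ closedGraphs) S.shiftGraph

end TwoSidedSubshift

/-! ### Continuous chromatic number at least three, via two-colorings -/

section ContinuousColorings

/-! Minimality comes from critical edges. Suppose `f` has no fixed point, its graph has no
continuous two-coloring, and for a dense set of points `y` some continuous two-coloring fails only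
on the edge from `y` to `f y`. A closed graph of CCN at least three that maps injectively and
continuously into it must hit all these edges, since otherwise the coloring pulls back. By
compactness the map is a homeomorphism, and closedness carries the edges over to all points, so the
map can be inverted (`exists_inverse_of_dense_critical`). A homeomorphism graph below a closed graph
is itself closed, so one argument settles both classes (`IsMinimalExample.of_critical`).

Except for the triangle in rank one, every example is an orbit closure. A sequence `X` over three
symbols, zero on the negative integers, is paired with a bit that alternates except for one mistake.
The orbit points are exactly the points of the closure with a mistake; they are isolated and dense,
and reading the bit at a fixed coordinate is a coloring that fails at just one of them. There is no
two-coloring: corrected by the bit, it would be constant on each half of the orbit and change at the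
mistake, although both halves accumulate at the same alternating zero sequence (`not_two_coloring`).
The remaining points come from limits of the right tails of `X`, so the choice of `X` fixes the rank
(`orbitClosure_isMinimalExample_of_tailLimits`).

The zero sequence gives rank two, and isolated spikes at powers of two give rank three. For rank `1
+ b + 3`, `X` lists longer and longer pieces of blocks coding finite sets along which an enumeration
of the ordinals below `b` decreases. These sets form a countable closed family in which the empty
set has rank `b`; the orbit below them adds one rank at the bottom, and the single spike and the
zero sequence lie above them.

For the antichain, a comparison between two spike examples acts on the orbits as a translation or a
reflection of the integers, which forces almost inclusion of the sets of exponents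
(`eventually_mem_of_le`). Almost disjoint sets are therefore incomparable. A basis has an element
below each of these minimal graphs, and closed codes in the Cantor space bound the number of
isomorphism classes from above. -/

theorem TopGraph.three_le_ccn_iff (X : TopGraph) :
    3 ≤ X.ccn ↔ ¬ ∃ c : X.V → Bool, IsLocallyConstant c ∧ ∀ x y, X.graph.Adj x y → c x ≠ c y := by
  constructor
  · rintro h ⟨c, hc, hp⟩
    have h2 : X.ccn ≤ 2 := by
      refine csInf_le' (Set.mem_insert_of_mem _ ⟨?_, Bool, c, by simp, hc, hp⟩)
      exact (natCast_lt_aleph0 (n := 2)).le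
    exact absurd (h.trans h2) (by norm_cast)
  · intro h
    refine le_csInf ⟨_, Set.mem_insert _ _⟩ ?_
    rintro κ (rfl | ⟨-, C, c, rfl, hc, hp⟩)
    · exact (nat_lt_continuum 3).le
    -- Fewer than three colors embed into `Bool`.
    · by_contra! hlt
      have h2 : #C ≤ #Bool := by
        have : #C < ((2 : ℕ) : Cardinal) + 1 := by
          refine hlt.trans_le ?_
          norm_num
        rw [lt_natCast_add_one_iff] at this
        simpa using this
      obtain ⟨e⟩ := h2
      exact h ⟨e ∘ c, hc.comp e, fun x y hxy he => hp x y hxy (e.injective he)⟩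

theorem TopGraph.two_lt_ccn_iff (X : TopGraph) : 2 < X.ccn ↔ 3 ≤ X.ccn := by
  have : (3 : Cardinal.{0}) = Order.succ 2 := by
    rw [show (2 : Cardinal.{0}) = ((2 : ℕ) : Cardinal) from rfl, succ_natCast]; norm_num
  rw [this, Order.succ_le_iff]

theorem TopGraph.ccn_eq_three (X : TopGraph) (h : 3 ≤ X.ccn) (c : X.V → Fin 3)
    (hc : IsLocallyConstant c) (hp : ∀ x y, X.graph.Adj x y → c x ≠ c y) : X.ccn = 3 := by
  refine le_antisymm (csInf_le' (Set.mem_insert_of_mem _ ⟨?_, Fin 3, c, by simp, hc, hp⟩)) h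
  exact (natCast_lt_aleph0 (n := 3)).le

end ContinuousColorings

/-! ### Closedness of induced graphs -/

section InducedGraph

variable {V : Type} {f : V → V}

theorem inducedGraph_adj {x y : V} :
    (inducedGraph f).Adj x y ↔ x ≠ y ∧ (f x = y ∨ f y = x) :=
  SimpleGraph.fromRel_adj _ _ _

theorem isClosed_inducedGraph [TopologicalSpace V] [T2Space V] (hf : Continuous f)
    (hfix : ∀ x, f x ≠ x) : IsClosed {p : V × V | (inducedGraph f).Adj p.1 p.2} := by
  have : {p : V × V | (inducedGraph f).Adj p.1 p.2} = {p | f p.1 = p.2} ∪ {p | f p.2 = p.1} := by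
    ext ⟨x, y⟩
    simp only [inducedGraph_adj, Set.mem_ofPred_eq, Set.mem_union, and_iff_right_iff_imp]
    rintro (rfl | rfl)
    · exact (hfix x).symm
    · exact hfix y
  rw [this]
  exact (isClosed_eq (hf.comp continuous_fst) continuous_snd).union
    (isClosed_eq (hf.comp continuous_snd) continuous_fst)

/-- A graph induced by a homeomorphism which maps homomorphically to a closed graph is closed. -/
theorem isClosed_inducedGraph_of_hom [TopologicalSpace V] [T2Space V] (hf : Continuous f)
    {W : Type} [TopologicalSpace W] {H : SimpleGraph W}
    (hH : IsClosed {p : W × W | H.Adj p.1 p.2}) {φ : V → W} (hφ : Continuous φ)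
    (hom : ∀ x y, (inducedGraph f).Adj x y → H.Adj (φ x) (φ y)) :
    IsClosed {p : V × V | (inducedGraph f).Adj p.1 p.2} := by
  -- Fixed points of `f` put diagonal pairs into the union; irreflexivity of `H` removes them by a
  -- closed condition.
  have : {p : V × V | (inducedGraph f).Adj p.1 p.2} =
      ({p | f p.1 = p.2} ∪ {p | f p.2 = p.1}) ∩ {p : V × V | H.Adj (φ p.1) (φ p.2)} := by
    ext ⟨x, y⟩
    simp only [Set.mem_ofPred_eq, Set.mem_union, Set.mem_inter_iff]
    constructor
    · intro h
      exact ⟨(inducedGraph_adj.1 h).2, hom _ _ h⟩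
    · rintro ⟨h, h'⟩
      refine inducedGraph_adj.2 ⟨?_, h⟩
      rintro rfl
      exact H.loopless.irrefl _ h'
  rw [this]
  exact ((isClosed_eq (hf.comp continuous_fst) continuous_snd).union
    (isClosed_eq (hf.comp continuous_snd) continuous_fst)).inter
    (hH.preimage ((hφ.comp continuous_fst).prodMk (hφ.comp continuous_snd)))

end InducedGraph

/-! ### Critical edges and minimality -/

section Minimality

/-- If deleting the edge from `y` to `f y` makes the graph continuously two-colorable, then
this edge is in the image of every homomorphism from a graph which is not continuously
two-colorable. -/
theorem exists_adj_of_almost_coloring {V : Type} [TopologicalSpace V] {f : V → V} {y : V}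
    {c : V → Bool} (hc : IsLocallyConstant c) (hy : ∀ z, z ≠ y → c (f z) ≠ c z)
    {Y : TopGraph} (hY : 3 ≤ Y.ccn) {φ : Y.V → V} (hφ : Continuous φ)
    (hom : ∀ u v, Y.graph.Adj u v → (inducedGraph f).Adj (φ u) (φ v)) :
    ∃ u v, Y.graph.Adj u v ∧ φ u = y ∧ φ v = f y := by
  by_contra! h
  refine (Y.three_le_ccn_iff.1 hY) ⟨c ∘ φ, hc.comp_continuous hφ, fun u v huv => ?_⟩
  rcases (inducedGraph_adj.1 (hom u v huv)).2 with h1 | h1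
  · have : φ u ≠ y := fun hu => h u v huv hu (by rw [← h1, hu])
    have := hy _ this
    rw [h1] at this
    exact this.symm
  · have : φ v ≠ y := fun hu => h v u huv.symm hu (by rw [← h1, hu])
    have := hy _ this
    rw [h1] at this
    exact this

/-- If the points `y` such that the edge from `y` to `f y` is critical are dense, then a continuous
injective homomorphism from a graph which is not continuously two-colorable is onto, and its
inverse is a homomorphism. -/
theorem exists_inverse_of_dense_critical {V : Type} [TopologicalSpace V] [T2Space V] {f : V → V}
    (hf : Continuous f) {D : Set V} (hD : Dense D)
    (hcrit : ∀ y ∈ D, ∃ c : V → Bool, IsLocallyConstant c ∧ ∀ z, z ≠ y → c (f z) ≠ c z)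
    {Y : TopGraph} (hY : Y ∈ closedGraphs) {φ : Y.V → V} (hφ : Continuous φ)
    (iφ : Function.Injective φ)
    (hom : ∀ u v, Y.graph.Adj u v → (inducedGraph f).Adj (φ u) (φ v)) :
    ∃ e : Y.V ≃ₜ V, ⇑e = φ ∧ ∀ x y, (inducedGraph f).Adj x y → Y.graph.Adj (e.symm x) (e.symm y) := by
  obtain ⟨⟨hcomp, hmet, -⟩, hcl, h3⟩ := hY
  have key : ∀ y ∈ D, ∃ u v, Y.graph.Adj u v ∧ φ u = y ∧ φ v = f y := by
    intro y hy
    obtain ⟨c, hc, h⟩ := hcrit y hy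
    exact exists_adj_of_almost_coloring hc h h3 hφ hom
  -- The range is compact, hence closed, and contains the dense set `D`.
  have hsurj : Function.Surjective φ := by
    rw [← Set.range_eq_univ, ← (isCompact_range hφ).isClosed.closure_eq, ← Set.univ_subset_iff,
      ← hD.closure_eq]
    refine closure_mono fun y hy => ?_
    obtain ⟨u, v, -, hu, -⟩ := key y hy
    exact ⟨u, hu⟩
  let e₀ : Y.V ≃ V := Equiv.ofBijective φ ⟨iφ, hsurj⟩
  have he₀ : Continuous e₀ := hφ
  let e : Y.V ≃ₜ V := he₀.homeoOfEquivCompactToT2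
  have he : ⇑e = φ := rfl
  have hadj : ∀ x, Y.graph.Adj (e.symm x) (e.symm (f x)) := by
    -- Closedness of the graph on `Y` is what extends the edges from `D` to its closure.
    have hcl' : IsClosed {x | Y.graph.Adj (e.symm x) (e.symm (f x))} :=
      hcl.preimage (e.symm.continuous.prodMk (e.symm.continuous.comp hf))
    intro x
    have : closure D ⊆ {x | Y.graph.Adj (e.symm x) (e.symm (f x))} := by
      refine hcl'.closure_subset_iff.2 fun y hy => ?_
      obtain ⟨u, v, huv, hu, hv⟩ := key y hy
      rw [← he] at hu hv
      rw [Set.mem_ofPred_eq, ← hv, ← hu]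
      simpa using huv
    exact this (hD x)
  refine ⟨e, he, fun x y hxy => ?_⟩
  rcases (inducedGraph_adj.1 hxy).2 with rfl | rfl
  · exact hadj x
  · exact (hadj y).symm

end Minimality

/-! ### Cantor–Bendixson derivatives from a rank function -/

section Rank

open CantorBendixson

/-- The iterated derived sets of a space, read off a rank function on an indexing of its points. -/
theorem iteratedDerivedSet_eq_image {X I : Type} [TopologicalSpace X] {q : I → X}
    (hq : Function.Surjective q) (r : I → Ordinal.{0})
    (hiso : ∀ i, ∃ U ∈ nhds (q i), ∀ j, q j ∈ U → j = i ∨ r j < r i)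
    (hlim : ∀ i, ∀ a < r i, ∀ U ∈ nhds (q i), ∃ j, j ≠ i ∧ q j ∈ U ∧ a ≤ r j) (a : Ordinal.{0}) :
    iteratedDerivedSet (Set.univ : Set X) a = q '' {i | a ≤ r i} := by
  -- Two different indices of one point would each have rank below the other.
  have hinj : Function.Injective q := by
    intro i j hij
    obtain ⟨U, hU, h⟩ := hiso i
    obtain ⟨W, hW, h'⟩ := hiso j
    rcases h j (hij ▸ mem_of_mem_nhds hU) with h1 | h1
    · exact h1.symm
    rcases h' i (hij ▸ mem_of_mem_nhds hW) with h2 | h2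
    · exact h2
    exact absurd h1 h2.not_gt
  induction a using Ordinal.limitRecOn with
  | zero => simp [hq.range_eq]
  | add_one a ih =>
    rw [iteratedDerivedSet_succ, ih]
    ext x
    obtain ⟨i, rfl⟩ := hq x
    rw [hinj.mem_set_image]
    simp only [relDerivedSet_apply, Set.mem_inter_iff, hinj.mem_set_image, Set.mem_ofPred_eq,
      mem_derivedSet, accPt_iff_nhds]
    rw [← Order.succ_eq_add_one, Order.succ_le_iff]
    constructor
    · rintro ⟨h1, h2⟩
      obtain ⟨U, hU, h⟩ := hiso i
      obtain ⟨y, ⟨hyU, j, hj, rfl⟩, hne⟩ := h1 U hU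
      rcases h j hyU with rfl | h3
      · exact absurd rfl hne
      · exact lt_of_le_of_lt hj h3
    · intro h
      refine ⟨fun U hU => ?_, h.le⟩
      obtain ⟨j, hne, hjU, hj⟩ := hlim i a h U hU
      exact ⟨q j, ⟨hjU, j, hj, rfl⟩, fun e => hne (hinj e)⟩
  | limit a ha ih =>
    rw [iteratedDerivedSet_limit ha]
    ext x
    obtain ⟨i, rfl⟩ := hq x
    simp only [Set.mem_iInter, Subtype.forall, Set.mem_Iio, hinj.mem_set_image, Set.mem_ofPred_eq]
    constructor
    · intro h
      refine ha.le_iff_forall_le.2 fun b hb => ?_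
      have := h b hb
      rwa [ih b hb, hinj.mem_set_image] at this
    · intro h b hb
      rw [ih b hb, hinj.mem_set_image]
      exact hb.le.trans h

end Rank

/-! ### Subshifts and the minimality criterion -/

namespace TwoSidedSubshift

variable (S : TwoSidedSubshift)

theorem continuous_shift : Continuous S.shift :=
  Continuous.subtype_mk (f := fun x : S.carrier => shiftMap x.1) (continuous_pi fun k =>
    (continuous_apply (k + 1)).comp continuous_subtype_val) _

theorem shift_bijective : Function.Bijective S.shift := by
  constructor
  · intro x y hxy
    have h : shiftMap x.1 = shiftMap y.1 := congrArg Subtype.val hxy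
    refine Subtype.ext (funext fun k => ?_)
    simpa [shiftMap] using congrFun h (k - 1)
  · intro y
    obtain ⟨x, hx, hxy⟩ := S.image_shift.superset y.2
    exact ⟨⟨x, hx⟩, Subtype.ext hxy⟩

instance : CompactSpace S.carrier :=
  haveI := S.finite
  haveI := S.discrete
  isCompact_iff_compactSpace.1 S.isClosed.isCompact

instance : T2Space S.carrier :=
  haveI := S.discrete
  inferInstance

theorem isZeroDimMetrizableCompact_carrier : IsZeroDimMetrizableCompact S.carrier := by
  have := S.finite
  have := S.discrete
  exact ⟨inferInstance, inferInstance, isTopologicalBasis_isClopen⟩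

theorem exists_homeomorph_shift :
    ∃ f : S.shiftGraph.V ≃ₜ S.shiftGraph.V, S.shiftGraph.graph = inducedGraph f := by
  have h : Continuous (Equiv.ofBijective S.shift S.shift_bijective) := S.continuous_shift
  exact ⟨h.homeoOfEquivCompactToT2, rfl⟩

variable {S}

/-- A criterion for being a minimal example: the edges which are critical for continuous
two-colorability are dense. -/
theorem IsMinimalExample.of_critical {ξ : Ordinal.{0}} (hcount : S.carrier.Countable)
    (hrank : S.HasCantorBendixsonRank ξ) (hfix : ∀ x, S.shift x ≠ x)
    (h2 : ∀ c : S.carrier → Bool, IsLocallyConstant c → ∃ x, c (S.shift x) = c x)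
    (h3 : ∃ c : S.carrier → Fin 3, IsLocallyConstant c ∧ ∀ x, c (S.shift x) ≠ c x)
    {D : Set S.carrier} (hD : Dense D)
    (hcrit : ∀ y ∈ D, ∃ c : S.carrier → Bool, IsLocallyConstant c ∧
      ∀ z, z ≠ y → c (S.shift z) ≠ c z) : S.IsMinimalExample ξ := by
  have three : 3 ≤ S.shiftGraph.ccn := by
    rw [TopGraph.three_le_ccn_iff]
    rintro ⟨c, hc, hp⟩
    obtain ⟨x, hx⟩ := h2 c hc
    exact hp (S.shift x) x (inducedGraph_adj.2 ⟨hfix x, Or.inr rfl⟩) hx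
  have hclosed : IsClosed {p : S.carrier × S.carrier | (inducedGraph S.shift).Adj p.1 p.2} :=
    isClosed_inducedGraph S.continuous_shift hfix
  have mclosed : Minimal (· ∈ closedGraphs) S.shiftGraph := by
    refine ⟨⟨S.isZeroDimMetrizableCompact_carrier, hclosed, three⟩, ?_⟩
    rintro Y hY ⟨φ, hφ, iφ, hom⟩
    obtain ⟨e, -, he⟩ := exists_inverse_of_dense_critical S.continuous_shift hD hcrit hY hφ iφ hom
    exact ⟨e.symm, e.symm.continuous, e.symm.injective, he⟩
  refine ⟨hcount, hrank, ?_, ⟨⟨S.isZeroDimMetrizableCompact_carrier, S.exists_homeomorph_shift,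
    (TopGraph.two_lt_ccn_iff _).2 three⟩, ?_⟩, mclosed⟩
  · obtain ⟨c, hc, hp⟩ := h3
    refine S.shiftGraph.ccn_eq_three three c hc fun x y hxy => ?_
    rcases (inducedGraph_adj.1 hxy).2 with rfl | rfl
    · exact (hp x).symm
    · exact hp y
  · rintro Y ⟨hY, ⟨f, hf⟩, hc⟩ hle
    -- Being below a closed graph makes the induced graph of `f` closed, so minimality among closed
    -- graphs applies.
    refine mclosed.2 ⟨hY, ?_, (TopGraph.two_lt_ccn_iff _).1 hc⟩ hle
    obtain ⟨φ, hφ, -, hom⟩ := hle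
    have := hY.metrizable
    rw [hf]
    exact isClosed_inducedGraph_of_hom f.continuous hclosed hφ (hf ▸ hom)

end TwoSidedSubshift

/-! ### Rank one: the triangle -/

section TriangleSubshift

/-- The periodic orbit of length three, as a subshift. -/
def triangleSubshift : TwoSidedSubshift where
  Alphabet := Fin 3
  top := ⊥
  discrete := ⟨rfl⟩
  carrier := {x | ∀ k, x (k + 1) = x k + 1}
  isClosed := by
    let _ : TopologicalSpace (Fin 3) := ⊥
    have : DiscreteTopology (Fin 3) := ⟨rfl⟩
    simp only [Set.ofPred_forall]
    exact isClosed_iInter fun k => isClosed_eq (continuous_apply _)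
      ((continuous_of_discreteTopology (f := fun a : Fin 3 => a + 1)).comp (continuous_apply k))
  image_shift := by
    ext x
    constructor
    · rintro ⟨y, hy, rfl⟩ k
      exact hy (k + 1)
    · intro hx
      refine ⟨fun k => x (k - 1), fun k => ?_, funext fun k => by simp [shiftMap]⟩
      simpa using hx (k - 1)

/-- The zeroth coordinate of a point of `triangleSubshift`. -/
def triangleCoord (x : triangleSubshift.carrier) : Fin 3 := x.1 0

theorem triangleSubshift_ext {x y : triangleSubshift.carrier}
    (h : triangleCoord x = triangleCoord y) : x = y := by
  refine Subtype.ext (funext fun k => ?_)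
  induction k with
  | zero => exact h
  | succ i ih => rw [x.2, y.2, ih]
  | pred i ih =>
    have h1 := x.2 (-i - 1)
    have h2 := y.2 (-i - 1)
    rw [sub_add_cancel] at h1 h2
    rw [h1, h2] at ih
    exact add_right_cancel (G := Fin 3) ih

theorem triangleSubshift_shift_zero (x : triangleSubshift.carrier) :
    triangleCoord (triangleSubshift.shift x) = triangleCoord x + 1 := x.2 0

instance : Finite triangleSubshift.carrier :=
  Finite.of_injective triangleCoord fun _ _ => triangleSubshift_ext

theorem triangleSubshift_nonempty : Nonempty triangleSubshift.carrier :=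
  ⟨fun k => ((k : ZMod 3) : Fin 3), fun k => by
    change ((k + 1 : ℤ) : ZMod 3) = (k : ZMod 3) + 1
    push_cast; rfl⟩

theorem triangleSubshift_isMinimalExample : triangleSubshift.IsMinimalExample 1 := by
  have hlc : ∀ {C : Type} (c : triangleSubshift.carrier → C), IsLocallyConstant c :=
    fun c => IsLocallyConstant.of_discrete c
  obtain ⟨x₀⟩ := triangleSubshift_nonempty
  -- Singling out the vertex `y + 2` of the triangle leaves the edge from `y` to `y + 1` as the only
  -- monochromatic one.
  refine .of_critical (Set.countable_coe_iff.1 inferInstance) ?_ (fun x hx => ?_) (fun c _ => ?_)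
    ⟨triangleCoord, hlc _, fun x => ?_⟩ dense_univ fun y _ => ⟨fun z => decide (triangleCoord z = triangleCoord y + 2), hlc _, fun z hz => ?_⟩
  · have key := iteratedDerivedSet_eq_image (q := (id : triangleSubshift.carrier → _))
      Function.surjective_id (fun _ => 0)
      (fun i => ⟨{i}, isOpen_discrete _ |>.mem_nhds rfl, fun j hj => Or.inl hj⟩)
      (fun i a ha => absurd ha not_lt_zero)
    constructor
    · rw [Set.mem_ofPred_eq, key]
      simp
    · intro a ha
      rw [Set.mem_ofPred_eq, key] at ha
      by_contra! h
      have : x₀ ∈ id '' {i : triangleSubshift.carrier | a ≤ (0 : Ordinal)} :=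
        ⟨x₀, by simpa using h, rfl⟩
      rw [ha] at this
      exact this
  · have := triangleSubshift_shift_zero x
    rw [hx] at this
    revert this
    generalize (triangleCoord x) = a
    decide +revert
  · by_contra! h
    have h3 : triangleSubshift.shift (triangleSubshift.shift (triangleSubshift.shift x₀)) = x₀ := by
      apply triangleSubshift_ext
      simp only [triangleSubshift_shift_zero]
      generalize (triangleCoord x₀) = a
      decide +revert
    have h0 := h x₀
    have h1 := h (triangleSubshift.shift x₀)
    have h2 := h (triangleSubshift.shift (triangleSubshift.shift x₀))
    rw [h3] at h2
    revert h0 h1 h2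
    cases c x₀ <;> cases c (triangleSubshift.shift x₀) <;>
      cases c (triangleSubshift.shift (triangleSubshift.shift x₀)) <;> simp
  · rw [triangleSubshift_shift_zero]
    generalize (triangleCoord x) = a
    decide +revert
  · have hz' : (triangleCoord z) ≠ triangleCoord y := fun h => hz (triangleSubshift_ext h)
    beta_reduce
    rw [triangleSubshift_shift_zero]
    revert hz'
    generalize (triangleCoord y) = a
    generalize (triangleCoord z) = b
    decide +revert

end TriangleSubshift

/-! ### Neighborhoods as agreement on finite windows -/

section Windows

/-- Neighborhoods of a sequence over a discrete alphabet. -/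
theorem mem_nhds_iff_window {A : Type} [TopologicalSpace A] [DiscreteTopology A] {y : ℤ → A}
    {U : Set (ℤ → A)} :
    U ∈ nhds y ↔ ∃ N : ℕ, ∀ z : ℤ → A, (∀ n : ℤ, |n| ≤ N → z n = y n) → z ∈ U := by
  constructor
  · intro h
    rw [nhds_pi, Filter.mem_pi] at h
    obtain ⟨I, hI, t, ht, hU⟩ := h
    obtain ⟨N, hN⟩ := (hI.image Int.natAbs).bddAbove
    refine ⟨N, fun z hz => hU fun i hi => ?_⟩
    have : |i| ≤ (N : ℤ) := by
      have := hN (Set.mem_image_of_mem _ hi)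
      rw [abs_le]
      omega
    rw [hz i this]
    exact mem_of_mem_nhds (ht i)
  · rintro ⟨N, h⟩
    refine Filter.mem_of_superset (set_pi_mem_nhds (Set.finite_Icc (-(N : ℤ)) N)
      (s := fun n => {y n}) fun n _ => (isOpen_discrete _).mem_nhds rfl) fun z hz => h z ?_
    exact fun n hn => hz n (abs_le.1 hn)

/-- Neighborhoods in a space of sequences over a discrete alphabet. -/
theorem mem_nhds_subtype_iff_window {A : Type} [TopologicalSpace A] [DiscreteTopology A]
    {C : Set (ℤ → A)} {y : C} {U : Set C} :
    U ∈ nhds y ↔ ∃ N : ℕ, ∀ z : C, (∀ n : ℤ, |n| ≤ N → z.1 n = y.1 n) → z ∈ U := by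
  rw [nhds_subtype, Filter.mem_comap]
  constructor
  · rintro ⟨W, hW, hU⟩
    obtain ⟨N, hN⟩ := mem_nhds_iff_window.1 hW
    exact ⟨N, fun z hz => hU (hN z.1 hz)⟩
  · rintro ⟨N, hN⟩
    exact ⟨{z | ∀ n : ℤ, |n| ≤ N → z n = y.1 n}, mem_nhds_iff_window.2 ⟨N, fun z hz => hz⟩,
      fun z hz => hN z hz⟩

end Windows

/-! ### Orbit closures with a single parity mistake -/

section OrbitClosure

/-- The sequence carrying the symbols of `X`, together with a parity which alternates everywhere
except between the coordinates `-1` and `0`. -/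
def markedSeq (X : ℤ → Fin 3) (n : ℤ) : Bool × Fin 3 := (xor n.bodd (decide (n < 0)), X n)

/-- The sequence carrying the symbols of `s`, together with an alternating parity. -/
def altSeq (p : Bool) (s : ℤ → Fin 3) (n : ℤ) : Bool × Fin 3 := (xor n.bodd p, s n)

/-- The set of sequences all of whose windows occur in `markedSeq X`. -/
def orbitClosureSet (X : ℤ → Fin 3) : Set (ℤ → Bool × Fin 3) :=
  {y | ∀ N : ℕ, ∃ k : ℤ, ∀ n : ℤ, |n| ≤ N → y n = markedSeq X (n + k)}

variable {X : ℤ → Fin 3}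

theorem orbitClosureSet_eq_closure :
    orbitClosureSet X = closure (Set.range fun (k n : ℤ) => markedSeq X (n + k)) := by
  ext y
  rw [mem_closure_iff_nhds]
  constructor
  · intro h U hU
    obtain ⟨N, hN⟩ := mem_nhds_iff_window.1 hU
    obtain ⟨k, hk⟩ := h N
    exact ⟨_, hN (fun n => markedSeq X (n + k)) fun n hn => (hk n hn).symm, k, rfl⟩
  · intro h N
    obtain ⟨_, hz, k, rfl⟩ := h {z | ∀ n : ℤ, |n| ≤ N → z n = y n}
      (mem_nhds_iff_window.2 ⟨N, fun z hz => hz⟩)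
    exact ⟨k, fun n hn => (hz n hn).symm⟩

theorem shift_mem_orbitClosureSet {y : ℤ → Bool × Fin 3} (hy : y ∈ orbitClosureSet X) (m : ℤ) :
    (fun n => y (n + m)) ∈ orbitClosureSet X := by
  intro N
  obtain ⟨k, hk⟩ := hy (N + m.natAbs)
  refine ⟨m + k, fun n hn => ?_⟩
  rw [← add_assoc]
  apply hk
  rw [abs_le] at hn ⊢
  omega

/-- The closure of the orbit of `markedSeq X`. -/
def orbitClosure (X : ℤ → Fin 3) : TwoSidedSubshift where
  Alphabet := Bool × Fin 3
  carrier := orbitClosureSet X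
  isClosed := by
    rw [orbitClosureSet_eq_closure]
    exact isClosed_closure
  image_shift := by
    ext y
    constructor
    · rintro ⟨z, hz, rfl⟩
      exact shift_mem_orbitClosureSet hz 1
    · intro hy
      exact ⟨_, shift_mem_orbitClosureSet hy (-1), funext fun n => by simp [shiftMap]⟩

/-- The points of the orbit of `markedSeq X`. -/
def orbitPoint (X : ℤ → Fin 3) (k : ℤ) : orbitClosureSet X :=
  ⟨fun n => markedSeq X (n + k), fun _ => ⟨k, fun _ _ => rfl⟩⟩

theorem shift_orbitPoint (k : ℤ) :
    (orbitClosure X).shift (orbitPoint X k) = orbitPoint X (k + 1) :=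
  Subtype.ext (funext fun n => congrArg (markedSeq X) (by ring))

theorem bodd_add_one (n : ℤ) : (n + 1).bodd = !n.bodd := by
  rw [Int.bodd_add]; simp

theorem bodd_two_mul (n : ℤ) : (2 * n).bodd = false := by
  rw [Int.bodd_mul, show Int.bodd 2 = false from rfl, Bool.false_and]

theorem markedSeq_parity {n : ℤ} :
    (markedSeq X n).1 = (markedSeq X (n + 1)).1 ↔ n = -1 := by
  simp only [markedSeq, bodd_add_one]
  rcases lt_trichotomy n (-1) with h | rfl | h
  · have h1 : n < 0 := by omega
    have h2 : n + 1 < 0 := by omega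
    simp [h1, h2, h.ne]
  · decide
  · have h1 : ¬ n < 0 := by omega
    have h2 : ¬ n + 1 < 0 := by omega
    simp [h1, h2, h.ne']

/-- The only points of the orbit closure whose parity fails to alternate are on the orbit. -/
theorem eq_orbitPoint_of_parity (y : orbitClosureSet X) {m : ℤ} (h : (y.1 m).1 = (y.1 (m + 1)).1) :
    y = orbitPoint X (-1 - m) := by
  refine Subtype.ext (funext fun t => ?_)
  obtain ⟨k, hk⟩ := y.2 (m.natAbs + 1 + t.natAbs)
  have h1 := hk m (by rw [abs_le]; omega)
  have h2 := hk (m + 1) (by rw [abs_le]; omega)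
  have h3 := hk t (by rw [abs_le]; omega)
  rw [h1, h2, add_right_comm, markedSeq_parity] at h
  rw [h3]
  change _ = markedSeq X _
  congr 1
  omega

/-- Any window is a window of `markedSeq X`, which has only one mistake. This excludes fixed points
of the shift and makes the three-coloring proper. -/
theorem not_parity_constant (y : orbitClosureSet X) (m : ℤ)
    (h : (y.1 m).1 = (y.1 (m + 1)).1) (h' : (y.1 (m + 1)).1 = (y.1 (m + 1 + 1)).1) : False := by
  obtain ⟨k, hk⟩ := y.2 (m.natAbs + 2)
  have h1 := hk m (by rw [abs_le]; omega)
  have h2 := hk (m + 1) (by rw [abs_le]; omega)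
  have h3 := hk (m + 1 + 1) (by rw [abs_le]; omega)
  rw [h1, h2, add_right_comm, markedSeq_parity] at h
  rw [h2, h3, add_right_comm (m + 1), markedSeq_parity] at h'
  omega

theorem orbitClosure_shift_ne (y : orbitClosureSet X) : (orbitClosure X).shift y ≠ y := by
  intro h
  have key : ∀ m, y.1 (m + 1) = y.1 m := fun m => congrFun (congrArg Subtype.val h) m
  exact not_parity_constant y 0 (by rw [key]) (by rw [key (0 + 1)])

theorem dense_range_orbitPoint : Dense (Set.range (orbitPoint X)) := by
  intro y
  rw [mem_closure_iff_nhds]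
  intro U hU
  obtain ⟨N, hN⟩ := mem_nhds_subtype_iff_window.1 hU
  obtain ⟨k, hk⟩ := y.2 N
  exact ⟨_, hN (orbitPoint X k) fun n hn => (hk n hn).symm, k, rfl⟩

theorem continuous_coord (m : ℤ) : Continuous fun y : orbitClosureSet X => y.1 m :=
  (continuous_apply m).comp continuous_subtype_val

theorem exists_almost_coloring (k : ℤ) : ∃ c : orbitClosureSet X → Bool, IsLocallyConstant c ∧
    ∀ z, z ≠ orbitPoint X k → c ((orbitClosure X).shift z) ≠ c z := by
  -- The mistake of `orbitPoint X k` lies between the coordinates `-1 - k` and `-k`.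
  refine ⟨fun y => (y.1 (-1 - k)).1, ?_, fun z hz h => hz ?_⟩
  · exact (IsLocallyConstant.iff_continuous _).2 (continuous_fst.comp (continuous_coord _))
  · have := eq_orbitPoint_of_parity z (m := -1 - k) h.symm
    rwa [show -1 - (-1 - k) = k by ring] at this

theorem exists_three_coloring : ∃ c : orbitClosureSet X → Fin 3, IsLocallyConstant c ∧
    ∀ z, c ((orbitClosure X).shift z) ≠ c z := by
  -- The third color marks a mistake at a fixed place; elsewhere the alternating bit is the color.
  let g : Bool × Bool → Fin 3 := fun p => if p.1 = p.2 then 2 else if p.2 then 1 else 0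
  refine ⟨fun y => g ((y.1 (-1)).1, (y.1 (-1 + 1)).1), ?_, fun z h => ?_⟩
  · refine (IsLocallyConstant.iff_continuous _).2 ((continuous_of_discreteTopology (f := g)).comp ?_)
    exact (continuous_fst.comp (continuous_coord _)).prodMk
      (continuous_fst.comp (continuous_coord _))
  · have h1 := not_parity_constant z (-1)
    change g ((z.1 (-1 + 1)).1, (z.1 (-1 + 1 + 1)).1) = g ((z.1 (-1)).1, (z.1 (-1 + 1)).1) at h
    revert h h1
    generalize (z.1 (-1)).1 = a
    generalize (z.1 (-1 + 1)).1 = b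
    generalize (z.1 (-1 + 1 + 1)).1 = c
    revert a b c
    decide

/-- The sequence `s` is a limit of the right tails of `X`, along places of parity `p`. -/
def IsTailLimit (X : ℤ → Fin 3) (p : Bool) (s : ℤ → Fin 3) : Prop :=
  ∀ N : ℕ, ∃ k : ℤ, N ≤ k ∧ k.bodd = p ∧ ∀ n : ℤ, |n| ≤ N → X (n + k) = s n

theorem markedSeq_eq_altSeq {p : Bool} {s : ℤ → Fin 3} {N : ℕ} {k : ℤ} (hk : N ≤ k)
    (hp : k.bodd = p) (h : ∀ n : ℤ, |n| ≤ N → X (n + k) = s n) {n : ℤ} (hn : |n| ≤ N) :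
    altSeq p s n = markedSeq X (n + k) := by
  have h0 : ¬ n + k < 0 := by rw [abs_le] at hn; omega
  simp [altSeq, markedSeq, h n hn, h0, Int.bodd_add, hp]

theorem IsTailLimit.mem {p : Bool} {s : ℤ → Fin 3} (h : IsTailLimit X p s) :
    altSeq p s ∈ orbitClosureSet X := by
  intro N
  obtain ⟨k, hk, hp, h⟩ := h N
  exact ⟨k, fun n hn => markedSeq_eq_altSeq hk hp h hn⟩

theorem exists_lt_bodd_eq (p : Bool) (N : ℕ) : ∃ k : ℤ, k < -N ∧ k.bodd = p := by
  cases p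
  · exact ⟨2 * (-N - 1), by omega, bodd_two_mul _⟩
  · exact ⟨2 * (-N - 1) + 1, by omega, by rw [bodd_add_one, bodd_two_mul]; rfl⟩

theorem exists_left_window (hX : ∀ n < 0, X n = 0) (p : Bool) (N : ℕ) :
    ∃ k < 0, ∀ n : ℤ, |n| ≤ N → altSeq p 0 n = markedSeq X (n + k) := by
  -- The parity is negated because `markedSeq` flips its bit at negative coordinates.
  obtain ⟨k, hk, hp⟩ := exists_lt_bodd_eq (!p) N
  refine ⟨k, by omega, fun n hn => ?_⟩
  have h0 : n + k < 0 := by rw [abs_le] at hn; omega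
  simp [altSeq, markedSeq, h0, Int.bodd_add, hp, hX _ h0]

theorem altSeq_zero_mem (hX : ∀ n < 0, X n = 0) (p : Bool) :
    altSeq p 0 ∈ orbitClosureSet X := by
  intro N
  obtain ⟨k, -, hk⟩ := exists_left_window hX p N
  exact ⟨k, hk⟩

theorem altSeq_of_parity {y : ℤ → Bool × Fin 3} (h : ∀ m, (y m).1 ≠ (y (m + 1)).1) :
    y = altSeq (y 0).1 fun n => (y n).2 := by
  refine funext fun n => Prod.ext ?_ rfl
  change (y n).1 = xor n.bodd (y 0).1
  induction n with
  | zero => simp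
  | succ i ih =>
    have := h i
    rw [ih] at this
    rw [bodd_add_one]
    revert this
    cases (y (i + 1)).1 <;> cases (i : ℤ).bodd <;> cases (y 0).1 <;> simp
  | pred i ih =>
    have := h (-i - 1)
    have h2 := bodd_add_one (-i - 1)
    rw [sub_add_cancel] at this h2
    rw [ih, h2] at this
    revert this
    cases (y (-i - 1)).1 <;> cases (-i - 1 : ℤ).bodd <;> cases (y 0).1 <;> simp

/-- The points of the orbit closure. -/
theorem orbitClosureSet_cases (hX : ∀ n < 0, X n = 0) (y : orbitClosureSet X) :
    (∃ k, y = orbitPoint X k) ∨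
      ∃ p s, y.1 = altSeq p s ∧ (s = 0 ∨ IsTailLimit X p s) := by
  by_cases horb : ∃ k, y = orbitPoint X k
  · exact Or.inl horb
  refine Or.inr ?_
  have hpar : ∀ m, (y.1 m).1 ≠ (y.1 (m + 1)).1 :=
    fun m h => horb ⟨_, eq_orbitPoint_of_parity y h⟩
  have hy := altSeq_of_parity hpar
  refine ⟨(y.1 0).1, _, hy, ?_⟩
  by_cases hs : (fun n => (y.1 n).2) = 0
  · exact Or.inl hs
  refine Or.inr fun N => ?_
  obtain ⟨t, ht⟩ := Function.ne_iff.1 hs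
  -- A nonzero symbol of `y` bounds from below the places where its windows occur. Each of the
  -- finitely many places between this bound and `N` is refuted at some coordinate, so a window
  -- reaching all of these occurs only beyond `N`.
  have hne : ∀ k, ∃ n, y.1 n ≠ markedSeq X (n + k) := by
    intro k
    by_contra! h
    exact horb ⟨k, Subtype.ext (funext h)⟩
  choose f hf using hne
  obtain ⟨M, hM⟩ := ((Set.finite_Icc (-(t.natAbs : ℤ)) N).image fun k => (f k).natAbs).bddAbove
  obtain ⟨k, hk⟩ := y.2 (N + t.natAbs + M)
  have hkt : -(t.natAbs : ℤ) ≤ k := by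
    by_contra! h
    have h1 := hk t (by rw [abs_le]; omega)
    apply ht
    change (y.1 t).2 = 0
    rw [h1]
    refine hX _ ?_
    have := le_abs_self t
    omega
  have hkN : (N : ℤ) < k := by
    by_contra! h
    have h1 : (f k).natAbs ≤ M := hM ⟨k, ⟨hkt, h⟩, rfl⟩
    exact hf k (hk (f k) (by rw [abs_le]; omega))
  refine ⟨k, hkN.le, ?_, fun n hn => ?_⟩
  · have h1 := hk 0 (by rw [abs_zero]; omega)
    have h2 : ¬ k < 0 := by omega
    rw [h1]
    simp [markedSeq, h2]
  · exact (congrArg Prod.snd (hk n (by rw [abs_le] at hn ⊢; omega))).symm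

/-- The sum of a two-coloring and the parity bit is continuous and changes along the orbit only at
the mistake. The point `altSeq false 0` is a limit of both halves of the orbit: on the left because
`X` vanishes there, on the right by `hgap`, where the parity `false` matters. -/
theorem not_two_coloring (hX : ∀ n < 0, X n = 0) (hgap : IsTailLimit X false 0)
    (c : orbitClosureSet X → Bool) (hc : IsLocallyConstant c) :
    ∃ x, c ((orbitClosure X).shift x) = c x := by
  by_contra! h
  let e : orbitClosureSet X → Bool := fun y => xor (c y) (y.1 0).1
  have he : Continuous e := by
    have h1 : Continuous fun y : orbitClosureSet X => (c y, (y.1 0).1) :=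
      hc.continuous.prodMk (continuous_fst.comp (continuous_coord 0))
    exact (continuous_of_discreteTopology (f := fun p : Bool × Bool => xor p.1 p.2)).comp h1
  have hstep : ∀ k, e (orbitPoint X (k + 1)) = xor (e (orbitPoint X k)) (decide (k = -1)) := by
    intro k
    have h1 := h (orbitPoint X k)
    rw [shift_orbitPoint] at h1
    have h2 := markedSeq_parity (X := X) (n := k)
    have h3 : ∀ k, ((orbitPoint X k).1 0).1 = (markedSeq X k).1 := fun k => by
      simp [orbitPoint]
    simp only [e, h3]
    revert h1 h2
    generalize c (orbitPoint X (k + 1)) = a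
    generalize c (orbitPoint X k) = b
    generalize (markedSeq X k).1 = u
    generalize (markedSeq X (k + 1)).1 = v
    by_cases hk : k = -1 <;> simp only [hk, iff_true, iff_false, decide_true, decide_false] <;>
      revert a b u v <;> decide
  have hright : ∀ i : ℕ, e (orbitPoint X i) = e (orbitPoint X 0) := by
    intro i
    induction i with
    | zero => rfl
    | succ i ih =>
      rw [Nat.cast_succ, hstep, ih]
      have : (i : ℤ) ≠ -1 := by omega
      simp [this]
  have hleft : ∀ i : ℕ, e (orbitPoint X (-1 - i)) = e (orbitPoint X (-1)) := by
    intro i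
    induction i with
    | zero => simp
    | succ i ih =>
      have h1 := hstep (-1 - (i + 1 : ℕ))
      rw [show (-1 - ((i + 1 : ℕ) : ℤ)) + 1 = -1 - i by push_cast; ring, ih] at h1
      have : (-1 - ((i + 1 : ℕ) : ℤ)) ≠ -1 := by omega
      rw [decide_eq_false this, Bool.xor_false] at h1
      exact h1.symm
  let z : orbitClosureSet X := ⟨altSeq false 0, altSeq_zero_mem hX false⟩
  obtain ⟨N, hN⟩ := mem_nhds_subtype_iff_window.1
    (he.continuousAt.preimage_mem_nhds ((isOpen_discrete {e z}).mem_nhds rfl))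
  obtain ⟨k, hk, hp, hk'⟩ := hgap N
  obtain ⟨l, hl, hl'⟩ := exists_left_window hX false N
  have h1 : e (orbitPoint X k) = e z := hN _ fun n hn => (markedSeq_eq_altSeq hk hp hk' hn).symm
  have h2 : e (orbitPoint X l) = e z := hN _ fun n hn => (hl' n hn).symm
  obtain ⟨i, rfl⟩ : ∃ i : ℕ, k = i := ⟨k.toNat, by omega⟩
  obtain ⟨j, rfl⟩ : ∃ j : ℕ, l = -1 - j := ⟨(-1 - l).toNat, by omega⟩
  rw [hright] at h1
  rw [hleft] at h2
  have h3 := hstep (-1)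
  rw [show (-1 : ℤ) + 1 = 0 by rfl, h1, h2] at h3
  simp at h3

theorem orbitClosure_isMinimalExample (hX : ∀ n < 0, X n = 0) (hgap : IsTailLimit X false 0)
    {ξ : Ordinal.{0}} (hcount : (orbitClosureSet X).Countable)
    (hrank : (orbitClosure X).HasCantorBendixsonRank ξ) :
    (orbitClosure X).IsMinimalExample ξ := by
  refine .of_critical hcount hrank orbitClosure_shift_ne (not_two_coloring hX hgap)
    exists_three_coloring dense_range_orbitPoint ?_
  rintro _ ⟨k, rfl⟩
  exact exists_almost_coloring k

end OrbitClosure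

/-! ### The rank from the limits of the tails -/

section TailLimits

variable {X : ℤ → Fin 3} {β : Type}

theorem altSeq_add (s : ℤ → Fin 3) (k n : ℤ) :
    altSeq false s (n + k) = altSeq k.bodd (fun n => s (n + k)) n := by
  simp [altSeq, Int.bodd_add]

theorem altSeq_parity_ne (p : Bool) (s : ℤ → Fin 3) (n : ℤ) :
    (altSeq p s n).1 ≠ (altSeq p s (n + 1)).1 := by
  simp only [altSeq, bodd_add_one]
  cases n.bodd <;> cases p <;> decide

theorem altSeq_inj {p p' : Bool} {s s' : ℤ → Fin 3} {n : ℤ} (h : altSeq p s n = altSeq p' s' n) :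
    p = p' ∧ s n = s' n := by
  obtain ⟨h1, h2⟩ := Prod.ext_iff.1 h
  exact ⟨Bool.xor_right_inj.1 h1, h2⟩

/-- The rank and the minimality of an orbit closure, when the limits of the tails of `X` are
zero and the shifts of a countable family `s` of sequences. -/
theorem orbitClosure_isMinimalExample_of_tailLimits [Countable β] {s : β → ℤ → Fin 3}
    {ρ : β → Ordinal.{0}} {τ : Ordinal.{0}}
    (hX : ∀ n < 0, X n = 0) (hgap : IsTailLimit X false 0) (hs : ∀ b, ∀ n < 0, s b n = 0)
    (hcases : ∀ p t, IsTailLimit X p t → t = 0 ∨ ∃ b k, t = (fun n => s b (n + k)) ∧ k.bodd = p)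
    (htail : ∀ b, IsTailLimit X false (s b))
    (hiso : ∀ b, ∃ N : ℕ, ∀ b' k, k.bodd = false → (∀ n : ℤ, |n| ≤ N → s b' (n + k) = s b n) →
      (b' = b ∧ k = 0) ∨ ρ b' < ρ b)
    (hne : ∀ b, ∃ n, s b n ≠ 0) (hρ : ∀ b, 1 ≤ ρ b) (hρτ : ∀ b, ρ b < τ) (hτ : 1 ≤ τ)
    (hacc : ∀ b, ∀ a < ρ b, a = 0 ∨ ∀ N : ℕ, ∃ b' k, k.bodd = false ∧ (b' ≠ b ∨ k ≠ 0) ∧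
      (∀ n : ℤ, |n| ≤ N → s b' (n + k) = s b n) ∧ a ≤ ρ b')
    (htop : ∀ a < τ, a = 0 ∨ ∃ b, a ≤ ρ b) :
    (orbitClosure X).IsMinimalExample (τ + 1) := by
  have hmem : ∀ b (k : ℤ), altSeq k.bodd (fun n => s b (n + k)) ∈ orbitClosureSet X := by
    intro b k
    have := shift_mem_orbitClosureSet (htail b).mem k
    simpa only [altSeq_add] using this
  let q : ℤ ⊕ (β × ℤ) ⊕ Bool → orbitClosureSet X :=
    Sum.elim (orbitPoint X) (Sum.elim (fun i => ⟨_, hmem i.1 i.2⟩)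
      (fun p => ⟨altSeq p 0, altSeq_zero_mem hX p⟩))
  let r : ℤ ⊕ (β × ℤ) ⊕ Bool → Ordinal.{0} :=
    Sum.elim (fun _ => 0) (Sum.elim (fun i => ρ i.1) (fun _ => τ))
  have hq : Function.Surjective q := by
    intro y
    rcases orbitClosureSet_cases hX y with ⟨k, rfl⟩ | ⟨p, t, hy, rfl | h⟩
    · exact ⟨Sum.inl k, rfl⟩
    · exact ⟨Sum.inr (Sum.inr p), Subtype.ext hy.symm⟩
    · rcases hcases p t h with rfl | ⟨b, k, rfl, rfl⟩
      · exact ⟨Sum.inr (Sum.inr p), Subtype.ext hy.symm⟩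
      · exact ⟨Sum.inr (Sum.inl (b, k)), Subtype.ext hy.symm⟩
  have key := iteratedDerivedSet_eq_image hq r ?_ ?_
  · refine orbitClosure_isMinimalExample hX hgap hq.countable ⟨?_, fun a ha => ?_⟩
    · refine (key _).trans (Set.image_eq_empty.2 (Set.eq_empty_of_forall_notMem fun i hi => ?_))
      have h1 : r i ≤ τ := by
        rcases i with k | ⟨b, k⟩ | p
        · exact zero_le
        · exact (hρτ b).le
        · exact le_rfl
      have h2 : τ + 1 ≤ τ := le_trans hi h1
      exact absurd h2 (not_le.2 (Order.lt_add_one_iff.2 le_rfl))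
    · have h1 := Set.image_eq_empty.1 ((key a).symm.trans ha)
      have h2 : ¬ a ≤ τ := Set.eq_empty_iff_forall_notMem.1 h1 (Sum.inr (Sum.inr false))
      rw [← Order.succ_eq_add_one, Order.succ_le_iff]
      exact not_le.1 h2
  · suffices H : ∀ i, ∃ N : ℕ, ∀ j, (∀ n : ℤ, |n| ≤ N → (q j).1 n = (q i).1 n) →
        j = i ∨ r j < r i by
      intro i
      obtain ⟨N, hN⟩ := H i
      exact ⟨{z | ∀ n : ℤ, |n| ≤ N → z.1 n = (q i).1 n},
        mem_nhds_subtype_iff_window.2 ⟨N, fun z hz => hz⟩, hN⟩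
    rintro (k | ⟨b, k⟩ | p)
    -- A window containing the mistake isolates an orbit point.
    · refine ⟨k.natAbs + 1, fun j hj => ?_⟩
      have h1 := congrArg Prod.fst (hj (-1 - k) (by rw [abs_le]; omega))
      have h2 := congrArg Prod.fst (hj (-1 - k + 1) (by rw [abs_le]; omega))
      have h3 : ((q (Sum.inl k)).1 (-1 - k)).1 = ((q (Sum.inl k)).1 (-1 - k + 1)).1 := by
        change (markedSeq X (-1 - k + k)).1 = (markedSeq X (-1 - k + 1 + k)).1
        rw [add_right_comm, markedSeq_parity]
        ring
      rw [← h1, ← h2] at h3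
      rcases j with l | ⟨b, l⟩ | p
      · change (markedSeq X (-1 - k + l)).1 = (markedSeq X (-1 - k + 1 + l)).1 at h3
        rw [add_right_comm, markedSeq_parity] at h3
        left
        congr 1
        omega
      · exact absurd h3 (altSeq_parity_ne _ _ _)
      · exact absurd h3 (altSeq_parity_ne _ _ _)
    · obtain ⟨N, hN⟩ := hiso b
      obtain ⟨t, ht⟩ := hne b
      refine ⟨N + t.natAbs + k.natAbs, ?_⟩
      rintro (l | ⟨b', l⟩ | p) hj
      · exact Or.inr (zero_lt_one.trans_le (hρ b))
      · replace hj : ∀ n : ℤ, |n| ≤ (N + t.natAbs + k.natAbs : ℕ) →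
          altSeq l.bodd (fun n => s b' (n + l)) n = altSeq k.bodd (fun n => s b (n + k)) n := hj
        have hp : l.bodd = k.bodd := (altSeq_inj (hj 0 (by rw [abs_zero]; omega))).1
        have hlk : (l - k).bodd = false := by
          have := Int.bodd_add (l - k) k
          rw [sub_add_cancel, hp] at this
          revert this
          cases k.bodd <;> cases (l - k).bodd <;> simp
        have hw : ∀ n : ℤ, |n| ≤ N → s b' (n + (l - k)) = s b n := by
          intro n hn
          have h2 := (altSeq_inj (hj (n - k) (by rw [abs_le] at hn ⊢; omega))).2
          simp only [sub_add_cancel] at h2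
          rwa [show n - k + l = n + (l - k) by ring] at h2
        rcases hN b' (l - k) hlk hw with ⟨rfl, h⟩ | h
        · exact Or.inl (by rw [sub_eq_zero.1 h])
        · exact Or.inr h
      · replace hj : ∀ n : ℤ, |n| ≤ (N + t.natAbs + k.natAbs : ℕ) →
          altSeq p 0 n = altSeq k.bodd (fun n => s b (n + k)) n := hj
        have h2 := (altSeq_inj (hj (t - k) (by rw [abs_le]; omega))).2
        simp only [sub_add_cancel] at h2
        exact absurd h2.symm ht
    -- Only the two alternating zero sequences have the top rank `τ`, and their bits at `0` differ.
    · refine ⟨0, ?_⟩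
      rintro (l | ⟨b', l⟩ | p') hj
      · exact Or.inr (zero_lt_one.trans_le hτ)
      · exact Or.inr (hρτ b')
      · have h : altSeq p' 0 0 = altSeq p 0 0 := hj 0 (by simp)
        rw [(altSeq_inj h).1]
        exact Or.inl rfl
  · suffices H : ∀ i, ∀ a < r i, ∀ N : ℕ, ∃ j, j ≠ i ∧
        (∀ n : ℤ, |n| ≤ N → (q j).1 n = (q i).1 n) ∧ a ≤ r j by
      intro i a ha U hU
      obtain ⟨N, hN⟩ := mem_nhds_subtype_iff_window.1 hU
      obtain ⟨j, h1, h2, h3⟩ := H i a ha N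
      exact ⟨j, h1, hN _ h2, h3⟩
    rintro (k | ⟨b, k⟩ | p) a ha N
    · exact absurd ha not_lt_zero
    · rcases hacc b a ha with rfl | h
      · obtain ⟨l, hl, hp, h⟩ := htail b (N + k.natAbs)
        refine ⟨Sum.inl (k + l), by simp, fun n hn => ?_, le_rfl⟩
        change markedSeq X (n + (k + l)) = altSeq k.bodd (fun n => s b (n + k)) n
        rw [← altSeq_add, markedSeq_eq_altSeq hl hp h, add_assoc]
        rw [abs_le] at hn ⊢
        omega
      · obtain ⟨b', l, hp, hne', hw, hr⟩ := h (N + k.natAbs)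
        refine ⟨Sum.inr (Sum.inl (b', l + k)), ?_, fun n hn => ?_, hr⟩
        · simp only [ne_eq, Sum.inr.injEq, Sum.inl.injEq, Prod.mk.injEq, not_and]
          rcases hne' with h | h
          · exact fun h' => absurd h' h
          · omega
        · change altSeq (l + k).bodd (fun n => s b' (n + (l + k))) n =
            altSeq k.bodd (fun n => s b (n + k)) n
          have := hw (n + k) (by rw [abs_le] at hn ⊢; omega)
          simp only [altSeq, Int.bodd_add, hp, Bool.false_xor]
          rw [← this]
          ring_nf
    · rcases htop a ha with rfl | ⟨b, hb⟩
      · obtain ⟨k, -, hk⟩ := exists_left_window hX p N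
        exact ⟨Sum.inl k, by simp, fun n hn => (hk n hn).symm, le_rfl⟩
      · obtain ⟨k, hk, hp⟩ := exists_lt_bodd_eq p N
        refine ⟨Sum.inr (Sum.inl (b, k)), by simp, fun n hn => ?_, hb⟩
        change altSeq k.bodd (fun n => s b (n + k)) n = altSeq p 0 n
        have := hs b (n + k) (by rw [abs_le] at hn; omega)
        simp [altSeq, hp, this]

/-- The closure of the orbit of the zero sequence with a parity mistake. -/
theorem orbitClosure_zero_isMinimalExample : (orbitClosure 0).IsMinimalExample 2 := by
  have h := orbitClosure_isMinimalExample_of_tailLimits (X := 0) (β := Empty)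
    (s := fun b => b.elim) (ρ := fun b => b.elim) (τ := 1) (fun _ _ => rfl)
    (fun N => ⟨2 * N, by omega, bodd_two_mul _, fun _ _ => rfl⟩) (fun b => b.elim)
    (fun p t ht => Or.inl (funext fun n => ?_)) (fun b => b.elim) (fun b => b.elim)
    (fun b => b.elim) (fun b => b.elim) (fun b => b.elim) le_rfl (fun b => b.elim)
    (fun a ha => Or.inl (by simpa using ha))
  · rwa [one_add_one_eq_two] at h
  · obtain ⟨k, -, -, h⟩ := ht n.natAbs
    exact (h n (by simp)).symm

end TailLimits

/-! ### Rank three: spikes at powers of two -/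

section Spikes

theorem two_mul_two_pow_le {i j : ℕ} (h : i < j) : 2 * (2 : ℤ) ^ (i + 1) ≤ 2 ^ (j + 1) := by
  rw [← pow_succ']
  exact pow_le_pow_right₀ (by norm_num) (by omega)

theorem natCast_lt_two_pow (i : ℕ) : (i : ℤ) < 2 ^ i := by
  exact_mod_cast Nat.lt_two_pow_self (n := i)

theorem bodd_two_pow_succ (i : ℕ) : ((2 : ℤ) ^ (i + 1)).bodd = false := by
  rw [pow_succ', bodd_two_mul]

/-- The sequence with a single nonzero symbol. -/
def singleSpike (n : ℤ) : Fin 3 := if n = 0 then 1 else 0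

open Classical in
/-- The sequence whose nonzero symbols are at the places `2 ^ (i + 1)` with `i ∈ P`. -/
noncomputable def spikes (P : Set ℕ) (n : ℤ) : Fin 3 := if ∃ i ∈ P, n = 2 ^ (i + 1) then 1 else 0

variable {P : Set ℕ}

theorem spikes_ne_zero {n : ℤ} : spikes P n ≠ 0 ↔ ∃ i ∈ P, n = 2 ^ (i + 1) := by
  simp [spikes]

theorem spikes_eq_zero {n : ℤ} : spikes P n = 0 ↔ ∀ i ∈ P, n ≠ 2 ^ (i + 1) := by
  rw [← not_iff_not, ← ne_eq, spikes_ne_zero]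
  push Not
  rfl

theorem spikes_of_neg {n : ℤ} (hn : n < 0) : spikes P n = 0 := by
  refine spikes_eq_zero.2 fun i _ h => ?_
  have : (0 : ℤ) < 2 ^ (i + 1) := by positivity
  omega

theorem spikes_two_pow {i : ℕ} (hi : i ∈ P) : spikes P (2 ^ (i + 1)) = 1 :=
  if_pos ⟨i, hi, rfl⟩

/-- The nearest other power of two is at distance `2 ^ i` from `2 ^ (i + 1)`. -/
theorem eq_of_two_pow_sub {i j : ℕ} {c : ℤ} (hc : |c| < 2 ^ i)
    (h : c + 2 ^ (i + 1) = 2 ^ (j + 1)) : j = i := by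
  rw [abs_lt] at hc
  have h1 : (2 : ℤ) ^ (i + 1) = 2 * 2 ^ i := pow_succ' _ _
  rcases lt_trichotomy i j with hij | hij | hij
  · have := two_mul_two_pow_le hij
    omega
  · exact hij.symm
  · have := two_mul_two_pow_le hij
    omega

theorem spikes_window {i : ℕ} (hi : i ∈ P) {n : ℤ} (hn : |n| ≤ i) :
    spikes P (n + 2 ^ (i + 1)) = singleSpike n := by
  by_cases h0 : n = 0
  · rw [h0, zero_add, spikes_two_pow hi]
    rfl
  · rw [singleSpike, if_neg h0]
    refine spikes_eq_zero.2 fun j _ h => h0 ?_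
    obtain rfl := eq_of_two_pow_sub (hn.trans_lt (natCast_lt_two_pow i)) h
    omega

theorem isTailLimit_singleSpike (hP : P.Infinite) : IsTailLimit (spikes P) false singleSpike := by
  intro N
  obtain ⟨i, hi, hN⟩ := hP.exists_gt N
  refine ⟨2 ^ (i + 1), ?_, bodd_two_pow_succ i, fun n hn => spikes_window hi (by omega)⟩
  have := natCast_lt_two_pow (i + 1)
  push_cast at this
  omega

theorem isTailLimit_spikes_zero : IsTailLimit (spikes P) false 0 := by
  intro N
  have hN := natCast_lt_two_pow N
  -- The midpoint of the consecutive powers `4 * 2 ^ N` and `8 * 2 ^ N`.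
  refine ⟨2 * (3 * 2 ^ N), by omega, bodd_two_mul _, fun n hn => spikes_eq_zero.2 fun i _ h => ?_⟩
  have h1 : (2 : ℤ) ^ (N + 1 + 1) = 4 * 2 ^ N := by ring
  rw [abs_le] at hn
  rcases le_or_gt i (N + 1) with hi | hi
  · have : (2 : ℤ) ^ (i + 1) ≤ 2 ^ (N + 1 + 1) := pow_le_pow_right₀ (by norm_num) (by omega)
    omega
  · have := two_mul_two_pow_le hi
    omega

theorem eq_singleSpike_of_isTailLimit {p : Bool} {t : ℤ → Fin 3} (h : IsTailLimit (spikes P) p t)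
    {u : ℤ} (hu : t u ≠ 0) : t = (fun n => singleSpike (n + -u)) ∧ (-u).bodd = p := by
  refine ⟨funext fun v => ?_, ?_⟩
  -- This far out, the spike at `u + k` is at a power of two so large that no other spike is within
  -- `|v - u|` of it.
  · obtain ⟨k, hk, -, hw⟩ := h (3 * (u.natAbs + v.natAbs) + 1)
    have h1 := hw u (by rw [abs_le]; omega)
    have h2 := hw v (by rw [abs_le]; omega)
    obtain ⟨i, hi, hui⟩ := spikes_ne_zero.1 (h1.trans_ne hu)
    have h3 : spikes P (v + k) = singleSpike (v + -u) := by
      by_cases huv : v = u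
      · rw [huv, hui, spikes_two_pow hi]
        simp [singleSpike]
      · rw [singleSpike, if_neg (by omega)]
        refine spikes_eq_zero.2 fun j _ hj => huv ?_
        have h4 := pow_succ' (2 : ℤ) i
        obtain rfl := eq_of_two_pow_sub (i := i) (j := j) (c := v - u)
          (by rw [abs_lt]; omega) (by omega)
        omega
    rw [← h2, h3]
  · obtain ⟨k, -, hp, hw⟩ := h u.natAbs
    have h1 := hw u (by rw [abs_le]; omega)
    obtain ⟨i, hi, hui⟩ := spikes_ne_zero.1 (h1.trans_ne hu)
    have h2 := bodd_two_pow_succ i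
    rw [← hui, Int.bodd_add, hp] at h2
    rw [Int.bodd_neg]
    revert h2
    cases u.bodd <;> cases p <;> decide

theorem orbitClosure_spikes_isMinimalExample (hP : P.Infinite) :
    (orbitClosure (spikes P)).IsMinimalExample 3 := by
  have h := orbitClosure_isMinimalExample_of_tailLimits (X := spikes P) (β := Unit)
    (s := fun _ => singleSpike) (ρ := fun _ => 1) (τ := 2) (fun _ => spikes_of_neg)
    isTailLimit_spikes_zero (fun _ n hn => if_neg hn.ne) (fun p t ht => ?_)
    (fun _ => isTailLimit_singleSpike hP) (fun _ => ⟨0, fun _ k _ hk => ?_⟩)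
    (fun _ => ⟨0, by simp [singleSpike]⟩) (fun _ => le_rfl) (fun _ => one_lt_two) one_le_two
    (fun _ a ha => Or.inl (by simpa using ha)) (fun a ha => Or.inr ⟨(), ?_⟩)
  · rwa [two_add_one_eq_three] at h
  · by_cases h0 : t = 0
    · exact Or.inl h0
    · obtain ⟨u, hu⟩ := Function.ne_iff.1 h0
      exact Or.inr ⟨(), -u, eq_singleSpike_of_isTailLimit ht hu⟩
  · left
    have := hk 0 (by simp)
    simpa [singleSpike] using this
  · rw [← one_add_one_eq_two] at ha
    exact Order.lt_add_one_iff.1 ha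

end Spikes

/-! ### The antichain of size continuum -/

section Antichain

theorem orbitPoint_injective {X : ℤ → Fin 3} : Function.Injective (orbitPoint X) := by
  intro k l h
  have h1 := (markedSeq_parity (X := X) (n := -1 - k + k)).2 (by ring)
  have h2 : ∀ n, markedSeq X (n + k) = markedSeq X (n + l) :=
    fun n => congrFun (congrArg Subtype.val h) n
  rw [add_right_comm, h2, h2, add_right_comm, markedSeq_parity] at h1
  omega

theorem isOpen_singleton_orbitPoint {X : ℤ → Fin 3} (k : ℤ) : IsOpen {orbitPoint X k} := by
  have : {orbitPoint X k} = {y : orbitClosureSet X | (y.1 (-1 - k)).1 = (y.1 (-1 - k + 1)).1} := by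
    ext y
    rw [Set.mem_singleton_iff, Set.mem_ofPred_eq]
    constructor
    · rintro rfl
      change (markedSeq X _).1 = (markedSeq X _).1
      rw [add_right_comm, markedSeq_parity]
      ring
    · intro h
      have := eq_orbitPoint_of_parity y h
      rwa [show -1 - (-1 - k) = k by ring] at this
  rw [this]
  have h : Continuous fun y : orbitClosureSet X => ((y.1 (-1 - k)).1, (y.1 (-1 - k + 1)).1) :=
    (continuous_fst.comp (continuous_coord _)).prodMk (continuous_fst.comp (continuous_coord _))
  exact (isOpen_discrete {p : Bool × Bool | p.1 = p.2}).preimage h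

/-- An injective path in the integers is a translation or a reflection. -/
theorem int_path_cases {g : ℤ → ℤ} (hg : Function.Injective g)
    (hstep : ∀ k, g (k + 1) = g k + 1 ∨ g k = g (k + 1) + 1) :
    (∀ k, g k = g 0 + k) ∨ ∀ k, g k = g 0 - k := by
  have key : ∀ k, g (k + 1 + 1) - g (k + 1) = g (k + 1) - g k := by
    intro k
    have h1 := hstep k
    have h2 := hstep (k + 1)
    have h3 : g (k + 1 + 1) ≠ g k := fun h => by have := hg h; omega
    omega
  have hconst : ∀ k, g (k + 1) - g k = g 1 - g 0 := by
    intro k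
    induction k with
    | zero => simp
    | succ i ih => rw [key, ih]
    | pred i ih =>
      have := key (-i - 1)
      rw [sub_add_cancel] at this ⊢
      rw [← this, ih]
  have hlin : ∀ k, g k = g 0 + k * (g 1 - g 0) := by
    intro k
    induction k with
    | zero => simp
    | succ i ih => linear_combination hconst i + ih
    | pred i ih =>
      have := hconst (-i - 1)
      rw [sub_add_cancel] at this
      linear_combination ih - this
  rcases hstep 0 with h | h
  · exact Or.inl fun k => by rw [hlin]; rw [zero_add] at h; rw [h]; ring
  · exact Or.inr fun k => by rw [hlin]; rw [zero_add] at h; rw [h]; ring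

/-- Comparable graphs of sequences of spikes have comparable sets of places, up to finite sets. -/
theorem eventually_mem_of_le {P Q : Set ℕ} (hP : P.Infinite)
    (h : (orbitClosure (spikes P)).shiftGraph ≤ (orbitClosure (spikes Q)).shiftGraph) :
    ∃ M, ∀ i ∈ P, M ≤ i → i ∈ Q := by
  obtain ⟨φ, hφ, iφ, hom⟩ := h
  have hcrit : ∀ y ∈ Set.range (orbitPoint (spikes Q)), ∃ c : orbitClosureSet (spikes Q) → Bool,
      IsLocallyConstant c ∧ ∀ z, z ≠ y → c ((orbitClosure (spikes Q)).shift z) ≠ c z := by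
    rintro _ ⟨k, rfl⟩
    exact exists_almost_coloring k
  obtain ⟨e, he, hadj⟩ := exists_inverse_of_dense_critical
    (orbitClosure (spikes Q)).continuous_shift dense_range_orbitPoint hcrit
    (orbitClosure_spikes_isMinimalExample hP).minimal_closed.1 hφ iφ hom
  -- Orbit points are isolated, and the preimage of an isolated point meets the dense orbit.
  have horb : ∀ k, ∃ l, e.symm (orbitPoint (spikes Q) k) = orbitPoint (spikes P) l := by
    intro k
    have h1 : IsOpen (e ⁻¹' {orbitPoint (spikes Q) k}) :=
      (isOpen_singleton_orbitPoint k).preimage e.continuous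
    obtain ⟨_, hx, l, rfl⟩ := dense_range_orbitPoint.inter_open_nonempty _ h1
      ⟨e.symm (orbitPoint (spikes Q) k), e.apply_symm_apply _⟩
    exact ⟨l, e.symm_apply_eq.2 hx.symm⟩
  choose g hg using horb
  have hg_inj : Function.Injective g := by
    intro k l hkl
    have := (hg k).trans ((congrArg _ hkl).trans (hg l).symm)
    exact orbitPoint_injective (e.symm.injective this)
  have hg_step : ∀ k, g (k + 1) = g k + 1 ∨ g k = g (k + 1) + 1 := by
    intro k
    have h1 := hadj (orbitPoint (spikes Q) k) (orbitPoint (spikes Q) (k + 1)) (inducedGraph_adj.2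
      ⟨fun h => by have := orbitPoint_injective h; omega, Or.inl (shift_orbitPoint k)⟩)
    rw [hg, hg] at h1
    rcases (inducedGraph_adj.1 h1).2 with h2 | h2
    · exact Or.inl (orbitPoint_injective ((shift_orbitPoint _).symm.trans h2)).symm
    · exact Or.inr (orbitPoint_injective ((shift_orbitPoint _).symm.trans h2)).symm
  let z : orbitClosureSet (spikes P) :=
    ⟨altSeq false singleSpike, (isTailLimit_singleSpike hP).mem⟩
  -- Otherwise `φ z` would have period two under the shift, hence a single neighbor, whereas `z` has
  -- two neighbors and `φ` is injective.
  obtain ⟨t, ht⟩ : ∃ t, ((φ z).1 t).2 ≠ 0 := by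
    by_contra! hzero
    obtain ⟨z', hz'⟩ := (orbitClosure (spikes P)).shift_bijective.2 z
    have hpar : ∀ m, ((φ z).1 m).1 ≠ ((φ z).1 (m + 1)).1 := by
      intro m hm
      have h1 : e z = orbitPoint (spikes Q) (-1 - m) := by
        rw [he]
        exact eq_orbitPoint_of_parity _ hm
      replace h1 : z = orbitPoint (spikes P) (g (-1 - m)) :=
        (e.symm_apply_apply z).symm.trans ((congrArg e.symm h1).trans (hg _))
      refine altSeq_parity_ne false singleSpike (-1 - g (-1 - m)) ?_
      change (z.1 _).1 = (z.1 _).1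
      rw [h1]
      change (markedSeq _ _).1 = (markedSeq _ _).1
      rw [add_right_comm, markedSeq_parity]
      ring
    have htwo : (orbitClosure (spikes Q)).shift ((orbitClosure (spikes Q)).shift (φ z)) = φ z := by
      refine Subtype.ext (funext fun n => Prod.ext ?_ ((hzero (n + 1 + 1)).trans (hzero n).symm))
      change ((φ z).1 (n + 1 + 1)).1 = ((φ z).1 n).1
      have h1 := hpar n
      have h2 := hpar (n + 1)
      revert h1 h2
      generalize ((φ z).1 n).1 = a
      generalize ((φ z).1 (n + 1)).1 = b
      generalize ((φ z).1 (n + 1 + 1)).1 = c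
      revert a b c
      decide
    have hnb : ∀ v, (inducedGraph (orbitClosure (spikes Q)).shift).Adj (φ z) v →
        v = (orbitClosure (spikes Q)).shift (φ z) := by
      intro v hv
      rcases (inducedGraph_adj.1 hv).2 with h1 | h1
      · exact h1.symm
      · exact (orbitClosure (spikes Q)).shift_bijective.1 (h1.trans htwo.symm)
    have h1 := hnb _ (hom z ((orbitClosure (spikes P)).shift z)
      (inducedGraph_adj.2 ⟨(orbitClosure_shift_ne z).symm, Or.inl rfl⟩))
    have h2 := hnb _ (hom z z' (inducedGraph_adj.2
      ⟨fun h => orbitClosure_shift_ne z' (hz'.trans h), Or.inr hz'⟩))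
    have h3 := iφ (h1.trans h2.symm)
    have h4 : (orbitClosure (spikes P)).shift ((orbitClosure (spikes P)).shift z) = z :=
      (congrArg _ h3).trans hz'
    have h5 := congrArg Prod.snd (congrFun (congrArg Subtype.val h4) 0)
    change singleSpike (0 + 1 + 1) = singleSpike 0 at h5
    revert h5
    decide
  have hcont : Continuous fun y : orbitClosureSet (spikes P) => ((φ y).1 t).2 :=
    continuous_snd.comp ((continuous_coord t).comp hφ)
  obtain ⟨N, hN⟩ := mem_nhds_subtype_iff_window.1
    (hcont.continuousAt.preimage_mem_nhds ((isOpen_discrete {((φ z).1 t).2}).mem_nhds rfl))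
  -- For such `i`, the orbit point at `2 ^ (i + 1)` is close to `z`, so its image has a nonzero
  -- symbol at `t`; moreover `|t - g 0| < 2 ^ i`. A translation then puts a spike of `Q` at this
  -- same power of two, while a reflection would put one at a negative place.
  refine ⟨N + t.natAbs + (g 0).natAbs + 1, fun i hi hMi => ?_⟩
  have hlt := natCast_lt_two_pow i
  have hpow := pow_succ' (2 : ℤ) i
  have hsym : ((φ (orbitPoint (spikes P) (2 ^ (i + 1)))).1 t).2 ≠ 0 := by
    have h1 : ((φ (orbitPoint (spikes P) (2 ^ (i + 1)))).1 t).2 = ((φ z).1 t).2 := by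
      refine hN _ fun n hn => ?_
      refine (markedSeq_eq_altSeq (N := N) (by omega) (bodd_two_pow_succ i) (fun n hn => ?_) hn).symm
      exact spikes_window hi (by omega)
    rwa [h1]
  have himg : ∀ k, φ (orbitPoint (spikes P) (g k)) = orbitPoint (spikes Q) k := by
    intro k
    rw [← he, ← hg]
    exact e.apply_symm_apply _
  rcases int_path_cases hg_inj hg_step with hlin | hlin
  · have h1 := himg (2 ^ (i + 1) - g 0)
    rw [hlin, add_sub_cancel] at h1
    rw [h1] at hsym
    obtain ⟨j, hj, hjt⟩ := spikes_ne_zero.1 hsym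
    obtain rfl := eq_of_two_pow_sub (i := i) (j := j) (c := t - g 0)
      (by rw [abs_lt]; omega) (by omega)
    exact hj
  · have h1 := himg (g 0 - 2 ^ (i + 1))
    rw [hlin, sub_sub_cancel] at h1
    rw [h1] at hsym
    obtain ⟨j, hj, hjt⟩ := spikes_ne_zero.1 hsym
    have : (0 : ℤ) < 2 ^ (j + 1) := by positivity
    omega

/-- The codes of the finite initial segments of `α`. -/
def branchCodes (α : ℕ → Bool) : Set ℕ :=
  Set.range fun n => Encodable.encode ((List.range n).map α)

theorem branchCodes_injective (α : ℕ → Bool) :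
    Function.Injective fun n => Encodable.encode ((List.range n).map α) := by
  intro m n h
  simpa using congrArg List.length (Encodable.encode_injective h)

theorem branchCodes_infinite (α : ℕ → Bool) : (branchCodes α).Infinite :=
  Set.infinite_range_of_injective (branchCodes_injective α)

theorem branchCodes_inter_finite {α β : ℕ → Bool} (h : α ≠ β) :
    (branchCodes α ∩ branchCodes β).Finite := by
  obtain ⟨m, hm⟩ := Function.ne_iff.1 h
  refine ((Set.finite_Iic m).image fun n => Encodable.encode ((List.range n).map α)).subset ?_
  rintro _ ⟨⟨n, rfl⟩, n', hn'⟩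
  refine ⟨n, ?_, rfl⟩
  by_contra! hlt
  rw [Set.mem_Iic, not_le] at hlt
  have h1 := Encodable.encode_injective hn'
  have h2 : n' = n := by simpa using congrArg List.length h1
  subst h2
  exact hm (List.map_inj_left.1 h1 m (List.mem_range.2 hlt)).symm

theorem orbitClosure_branchCodes_not_le {α β : ℕ → Bool} (h : α ≠ β) :
    ¬ (orbitClosure (spikes (branchCodes α))).shiftGraph ≤
      (orbitClosure (spikes (branchCodes β))).shiftGraph := by
  intro hle
  obtain ⟨M, hM⟩ := eventually_mem_of_le (branchCodes_infinite α) hle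
  refine branchCodes_infinite α (((Set.finite_Iio M).union (branchCodes_inter_finite h)).subset ?_)
  intro i hi
  rcases lt_or_ge i M with h1 | h1
  · exact Or.inl h1
  · exact Or.inr ⟨hi, hM i hi h1⟩

end Antichain

/-! ### Concatenations of blocks and their tail limits -/

section Blocks

/-- A marker at `0`, followed by spikes at the places `2 ^ (j + 1)` with `j ∈ B`. -/
noncomputable def blockSeq (B : Set ℕ) (n : ℤ) : Fin 3 := if n = 0 then 2 else spikes B n

open Classical in
/-- Longer and longer initial segments of the sequences `blockSeq (G i)`, starting at the places
`4 ^ (i + 2)`. -/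
noncomputable def blockConcat (G : ℕ → Set ℕ) (n : ℤ) : Fin 3 :=
  if ∃ i : ℕ, n = 16 * 4 ^ i then 2
  else if ∃ i j : ℕ, j ∈ G i ∧ j ≤ i ∧ n = 16 * 4 ^ i + 2 ^ (j + 1) then 1 else 0

variable {B : Set ℕ} {G : ℕ → Set ℕ}

theorem blockSeq_zero : blockSeq B 0 = 2 := if_pos rfl

theorem blockSeq_of_ne {n : ℤ} (hn : n ≠ 0) : blockSeq B n = spikes B n := if_neg hn

theorem spikes_ne_two (n : ℤ) : spikes B n ≠ 2 := by
  unfold spikes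
  split_ifs <;> decide

theorem blockSeq_eq_two {n : ℤ} : blockSeq B n = 2 ↔ n = 0 := by
  refine ⟨fun h => ?_, fun h => h ▸ blockSeq_zero⟩
  by_contra hn
  rw [blockSeq_of_ne hn] at h
  exact spikes_ne_two n h

theorem blockSeq_two_pow {j : ℕ} : blockSeq B (2 ^ (j + 1)) ≠ 0 ↔ j ∈ B := by
  rw [blockSeq_of_ne (by positivity), spikes_ne_zero]
  constructor
  · rintro ⟨i, hi, h⟩
    have : (2 : ℕ) ^ (j + 1) = 2 ^ (i + 1) := by exact_mod_cast h
    have := Nat.pow_right_injective le_rfl this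
    rwa [show j = i by omega]
  · exact fun h => ⟨j, h, rfl⟩

theorem blockSeq_window {i : ℕ} (hi : i ∈ B) {n : ℤ} (hn : |n| ≤ i) :
    blockSeq B (n + 2 ^ (i + 1)) = singleSpike n := by
  rw [blockSeq_of_ne, spikes_window hi hn]
  have := natCast_lt_two_pow (i + 1)
  push_cast at this
  rw [abs_le] at hn
  omega

theorem two_pow_le_two_mul_four_pow {i j : ℕ} (h : j ≤ i) : (2 : ℤ) ^ (j + 1) ≤ 2 * 4 ^ i := by
  rw [pow_succ']
  have h1 : (2 : ℤ) ^ j ≤ 2 ^ i := pow_le_pow_right₀ (by norm_num) h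
  have h2 : (2 : ℤ) ^ i ≤ 4 ^ i := pow_le_pow_left₀ (by norm_num) (by norm_num) i
  omega

theorem natCast_lt_four_pow (i : ℕ) : (i : ℤ) < 4 ^ i := by
  exact_mod_cast Nat.lt_pow_self (n := i) (a := 4) (by norm_num)

theorem four_mul_four_pow_le {i j : ℕ} (h : i < j) : 4 * (4 : ℤ) ^ i ≤ 4 ^ j := by
  rw [← pow_succ']
  exact pow_le_pow_right₀ (by norm_num) h

theorem blockConcat_cases {n : ℤ} (h : blockConcat G n ≠ 0) : ∃ (i : ℕ) (v : ℤ),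
    n = 16 * 4 ^ i + v ∧ 0 ≤ v ∧ v ≤ 2 * 4 ^ i ∧
      ((v = 0 ∧ blockConcat G n = 2) ∨ ∃ j ∈ G i, v = 2 ^ (j + 1) ∧ blockConcat G n = 1) := by
  unfold blockConcat at h ⊢
  split_ifs at h ⊢ with h1 h2
  · obtain ⟨i, hi⟩ := h1
    exact ⟨i, 0, by omega, le_rfl, by positivity, Or.inl ⟨rfl, rfl⟩⟩
  · obtain ⟨i, j, hj, hji, rfl⟩ := h2
    exact ⟨i, _, rfl, by positivity, two_pow_le_two_mul_four_pow hji, Or.inr ⟨j, hj, rfl, rfl⟩⟩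
  · exact absurd rfl h

theorem blockConcat_start (i : ℕ) : blockConcat G (16 * 4 ^ i) = 2 := if_pos ⟨i, rfl⟩

theorem blockConcat_eq_two {n : ℤ} : blockConcat G n = 2 ↔ ∃ i : ℕ, n = 16 * 4 ^ i := by
  constructor
  · intro h
    unfold blockConcat at h
    split_ifs at h with h1
    · exact h1
    · exact absurd h (by decide)
    · exact absurd h (by decide)
  · rintro ⟨i, rfl⟩
    exact blockConcat_start i

theorem blockConcat_add {i j : ℕ} (hj : j ∈ G i) (hji : j ≤ i) :
    blockConcat G (16 * 4 ^ i + 2 ^ (j + 1)) = 1 := by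
  unfold blockConcat
  rw [if_neg, if_pos ⟨i, j, hj, hji, rfl⟩]
  rintro ⟨l, hl⟩
  have h1 := two_pow_le_two_mul_four_pow hji
  have h2 : (0 : ℤ) < 2 ^ (j + 1) := by positivity
  rcases lt_trichotomy i l with h | rfl | h
  · have := four_mul_four_pow_le h
    omega
  · omega
  · have := four_mul_four_pow_le h
    have : (0 : ℤ) < 4 ^ l := by positivity
    omega

theorem blockConcat_of_neg {n : ℤ} (hn : n < 0) : blockConcat G n = 0 := by
  by_contra h
  obtain ⟨i, v, rfl, hv, -, -⟩ := blockConcat_cases h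
  have : (0 : ℤ) < 4 ^ i := by positivity
  omega

/-- The other blocks are farther than `i` from the start of block `i`, and its truncation drops only
places beyond the window. -/
theorem blockConcat_window {i : ℕ} {n : ℤ} (hn : |n| ≤ i) :
    blockConcat G (n + 16 * 4 ^ i) = blockSeq (G i) n := by
  by_cases h0 : n = 0
  · rw [h0, zero_add, blockConcat_start, blockSeq_zero]
  rw [blockSeq_of_ne h0]
  by_cases hs : ∃ j ∈ G i, n = 2 ^ (j + 1)
  · obtain ⟨j, hj, rfl⟩ := hs
    have h1 := natCast_lt_two_pow (j + 1)
    have h2 := le_abs_self ((2 : ℤ) ^ (j + 1))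
    push_cast at h1
    rw [add_comm, blockConcat_add hj (by omega), spikes_two_pow hj]
  · rw [← spikes_ne_zero, not_ne_iff] at hs
    rw [hs]
    by_contra hne
    obtain ⟨l, v, hl, hv0, hv, hcases⟩ := blockConcat_cases hne
    have h4 := natCast_lt_four_pow i
    rw [abs_le] at hn
    rcases lt_trichotomy i l with h | rfl | h
    · have := four_mul_four_pow_le h
      omega
    · rcases hcases with ⟨rfl, -⟩ | ⟨j, hj, rfl, -⟩
      · omega
      · obtain rfl : n = 2 ^ (j + 1) := by omega
        exact spikes_ne_zero.2 ⟨j, hj, rfl⟩ hs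
    · have := four_mul_four_pow_le h
      omega

/-- Gaps between blocks are large relative to their position, so `hfar` puts both symbols in one
block. Inside it, places are powers of two, so the distance between two of them is at least half of
the larger one, and the marker is near. Thus a tail limit with two nonzero symbols contains a
marker. -/
theorem exists_start_of_pair {e e' : ℤ} (he : blockConcat G e ≠ 0) (he' : blockConcat G e' ≠ 0)
    (hlt : e < e') (hfar : 2 * (e' - e) ≤ e) :
    ∃ v, 0 ≤ v ∧ v ≤ 2 * (e' - e) ∧ blockConcat G (e' - v) = 2 := by
  obtain ⟨i, v, hi, hv0, hv, hc⟩ := blockConcat_cases he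
  obtain ⟨i', v', hi', hv0', hv', hc'⟩ := blockConcat_cases he'
  rcases lt_trichotomy i i' with h | rfl | h
  · have := four_mul_four_pow_le h
    have : (0 : ℤ) < 4 ^ i := by positivity
    omega
  · refine ⟨v', hv0', ?_, blockConcat_eq_two.2 ⟨i, by omega⟩⟩
    rcases hc with ⟨rfl, -⟩ | ⟨j, hj, rfl, -⟩
    · omega
    rcases hc' with ⟨rfl, -⟩ | ⟨j', hj', rfl, -⟩
    · omega
    have hjj : j < j' := by
      by_contra! hle
      have : (2 : ℤ) ^ (j' + 1) ≤ 2 ^ (j + 1) := pow_le_pow_right₀ (by norm_num) (by omega)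
      omega
    have := two_mul_two_pow_le hjj
    omega
  · have := four_mul_four_pow_le h
    have : (0 : ℤ) < 4 ^ i' := by positivity
    omega

theorem blockConcat_bodd {n : ℤ} (h : blockConcat G n ≠ 0) : n.bodd = false := by
  have h1 : ∀ i : ℕ, (16 * (4 : ℤ) ^ i).bodd = false := fun i => by
    rw [show (16 : ℤ) * 4 ^ i = 2 * (8 * 4 ^ i) by ring, bodd_two_mul]
  obtain ⟨i, v, rfl, -, -, ⟨rfl, -⟩ | ⟨j, -, rfl, -⟩⟩ := blockConcat_cases h
  · rw [add_zero, h1]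
  · rw [Int.bodd_add, h1, bodd_two_pow_succ]
    rfl

theorem bodd_neg_of_bodd_add {p : Bool} {u k : ℤ} (h : (u + k).bodd = false) (hk : k.bodd = p) :
    (-u).bodd = p := by
  rw [Int.bodd_add, hk] at h
  rw [Int.bodd_neg]
  revert h
  cases u.bodd <;> cases p <;> decide

/-- A tail limit with a marker looks locally like one of the blocks. -/
theorem IsTailLimit.exists_block {p : Bool} {t : ℤ → Fin 3} (h : IsTailLimit (blockConcat G) p t)
    {c : ℤ} (hc : t c = 2) :
    (-c).bodd = p ∧ ∀ N : ℕ, ∃ i, ∀ n : ℤ, |n| ≤ N → t (n + c) = blockSeq (G i) n := by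
  constructor
  · obtain ⟨k, -, hp, hw⟩ := h c.natAbs
    refine bodd_neg_of_bodd_add (blockConcat_bodd (G := G) ?_) hp
    rw [hw c (by rw [abs_le]; omega), hc]
    decide
  · intro N
    -- Taken so far out, the marker starts a block of index at least `N`, whose window of radius `N`
    -- is not truncated.
    obtain ⟨k, hk, -, hw⟩ := h (N + c.natAbs + 16 * 4 ^ N)
    simp only [Nat.cast_add, Nat.cast_mul, Nat.cast_pow, Nat.cast_ofNat] at hk hw
    have h1 : (0 : ℤ) < 4 ^ N := by positivity
    obtain ⟨i, hi⟩ := blockConcat_eq_two.1 ((hw c (by rw [abs_le]; omega)).trans hc)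
    have hNi : N ≤ i := by
      by_contra! hlt
      have := four_mul_four_pow_le hlt
      omega
    refine ⟨i, fun n hn => ?_⟩
    rw [← hw (n + c) (by rw [abs_le] at hn ⊢; omega), ← blockConcat_window (by omega), ← hi]
    ring_nf

/-- A nonzero tail limit without a marker has a single spike. -/
theorem IsTailLimit.eq_singleSpike {p : Bool} {t : ℤ → Fin 3}
    (h : IsTailLimit (blockConcat G) p t) (h2 : ∀ c, t c ≠ 2) {u : ℤ} (hu : t u ≠ 0) :
    t = (fun n => singleSpike (n + -u)) ∧ (-u).bodd = p := by
  have hpair : ∀ u v, u < v → t u ≠ 0 → t v = 0 := by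
    intro u v huv hu
    by_contra hv
    -- The factor 4 serves twice: the pair is far out relative to its distance, and the marker it
    -- forces falls inside the window.
    obtain ⟨k, hk, -, hw⟩ := h (4 * (u.natAbs + v.natAbs))
    simp only [Nat.cast_add, Nat.cast_mul, Nat.cast_ofNat] at hk hw
    have h3 := hw u (by rw [abs_le]; omega)
    have h4 := hw v (by rw [abs_le]; omega)
    obtain ⟨w, hw0, hwle, hstart⟩ := exists_start_of_pair (G := G) (e := u + k) (e' := v + k)
      (h3.trans_ne hu) (h4.trans_ne hv) (by omega) (by omega)
    refine h2 (v - w) ?_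
    rw [← hw (v - w) (by rw [abs_le]; omega), ← hstart]
    ring_nf
  refine ⟨funext fun v => ?_, ?_⟩
  · by_cases huv : v = u
    · have h3 := h2 u
      rw [huv, add_neg_cancel]
      change t u = 1
      revert hu h3
      generalize t u = a
      revert a
      decide
    · rw [singleSpike, if_neg (by omega)]
      rcases lt_or_gt_of_ne huv with hlt | hlt
      · by_contra hv
        exact hu (hpair v u hlt hv)
      · exact hpair u v hlt hu
  · obtain ⟨k, -, hp, hw⟩ := h u.natAbs
    refine bodd_neg_of_bodd_add (blockConcat_bodd (G := G) ?_) hp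
    rwa [hw u (by rw [abs_le]; omega)]

theorem IsTailLimit.of_approx {X : ℤ → Fin 3} {p : Bool} {t : ℤ → Fin 3}
    (h : ∀ N : ℕ, ∃ s k, k.bodd = false ∧ IsTailLimit X p s ∧ ∀ n : ℤ, |n| ≤ N → s (n + k) = t n) :
    IsTailLimit X p t := by
  intro N
  obtain ⟨s, k, hk, hs, hw⟩ := h N
  obtain ⟨l, hl, hp, hl'⟩ := hs (N + k.natAbs)
  refine ⟨k + l, by omega, by rw [Int.bodd_add, hk, hp, Bool.false_xor], fun n hn => ?_⟩
  rw [← hw n hn, ← hl' (n + k) (by rw [abs_le] at hn ⊢; omega), add_assoc]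

end Blocks

/-! ### Rank `η + 3`: blocks coding decreasing sets -/

section DecreasingSets

variable {d : ℕ → Ordinal.{0}} {b : Ordinal.{0}}

/-- The finite sets on which `d` is decreasing and smaller than `b`. -/
def IsDecreasingSet (d : ℕ → Ordinal.{0}) (b : Ordinal.{0}) (F : Finset ℕ) : Prop :=
  (∀ i ∈ F, d i < b) ∧ ∀ i ∈ F, ∀ j ∈ F, i < j → d j < d i

/-- The rank of a decreasing set, in the space of the decreasing sets. -/
noncomputable def decreasingRank (d : ℕ → Ordinal.{0}) (b : Ordinal.{0}) (F : Finset ℕ) :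
    Ordinal.{0} := sInf (insert b (d '' F))

theorem decreasingRank_le (F : Finset ℕ) : decreasingRank d b F ≤ b :=
  csInf_le' (Set.mem_insert _ _)

theorem decreasingRank_empty : decreasingRank d b ∅ = b := by
  simp [decreasingRank]

theorem decreasingRank_le_of_mem {F : Finset ℕ} {i : ℕ} (hi : i ∈ F) : decreasingRank d b F ≤ d i :=
  csInf_le' (Set.mem_insert_of_mem _ ⟨i, hi, rfl⟩)

theorem le_decreasingRank {F : Finset ℕ} {a : Ordinal.{0}} (hb : a ≤ b) (hF : ∀ i ∈ F, a ≤ d i) :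
    a ≤ decreasingRank d b F := by
  refine le_csInf ⟨_, Set.mem_insert _ _⟩ ?_
  rintro _ (rfl | ⟨i, hi, rfl⟩)
  · exact hb
  · exact hF i hi

theorem lt_decreasingRank {F : Finset ℕ} {a : Ordinal.{0}} (hb : a < b) (hF : ∀ i ∈ F, a < d i) :
    a < decreasingRank d b F := by
  have : decreasingRank d b F ∈ insert b (d '' F) := csInf_mem ⟨_, Set.mem_insert _ _⟩
  rcases this with h | ⟨i, hi, h⟩
  · rwa [h]
  · rw [← h]
    exact hF i hi

/-- The code of a set of natural numbers as an infinite set of natural numbers. -/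
def evenOddCode (F : Finset ℕ) : Set ℕ := {j | Even j ∨ ∃ i ∈ F, j = 2 * i + 1}

theorem odd_mem_evenOddCode {F : Finset ℕ} {i : ℕ} : 2 * i + 1 ∈ evenOddCode F ↔ i ∈ F := by
  constructor
  · rintro (h | ⟨j, hj, h⟩)
    · exact absurd h (by simp)
    · rwa [show i = j by omega]
  · exact fun h => Or.inr ⟨i, h, rfl⟩

/-- The even places make every code infinite, so each block sequence has the single spike as a limit
of its right tails; the odd places carry `F`. -/
theorem even_mem_evenOddCode {F : Finset ℕ} {i : ℕ} : 2 * i ∈ evenOddCode F :=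
  Or.inl (even_two_mul i)

/-- Two sequences of blocks agree on a window if the sets of places agree there. -/
theorem blockSeq_evenOddCode_congr {F F' : Finset ℕ} {N : ℕ} (h : ∀ i ≤ N, i ∈ F ↔ i ∈ F') {n : ℤ}
    (hn : |n| ≤ N) : blockSeq (evenOddCode F) n = blockSeq (evenOddCode F') n := by
  have key : ∀ {F F' : Finset ℕ}, (∀ i ≤ N, i ∈ F ↔ i ∈ F') → n ≠ 0 →
      spikes (evenOddCode F) n ≠ 0 → spikes (evenOddCode F) n = spikes (evenOddCode F') n := by
    intro F F' h h0 hne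
    obtain ⟨j, hj, rfl⟩ := spikes_ne_zero.1 hne
    have hjN := natCast_lt_two_pow (j + 1)
    rw [abs_le] at hn
    rw [spikes_two_pow hj, spikes_two_pow]
    rcases hj with hj | ⟨i, hi, rfl⟩
    · exact Or.inl hj
    · exact Or.inr ⟨i, (h i (by omega)).1 hi, rfl⟩
  by_cases h0 : n = 0
  · rw [h0, blockSeq_zero, blockSeq_zero]
  rw [blockSeq_of_ne h0, blockSeq_of_ne h0]
  by_cases h1 : spikes (evenOddCode F) n = 0
  · by_cases h2 : spikes (evenOddCode F') n = 0
    · rw [h1, h2]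
    · exact (key (fun i hi => (h i hi).symm) h0 h2).symm
  · exact key h h0 h1

/-- The sequences coding the decreasing sets are a closed family. -/
theorem exists_blockSeq_eq_of_forall_window {t : ℤ → Fin 3}
    (h : ∀ N : ℕ, ∃ F, IsDecreasingSet d b F ∧
      ∀ n : ℤ, |n| ≤ N → t n = blockSeq (evenOddCode F) n) :
    ∃ F, IsDecreasingSet d b F ∧ t = blockSeq (evenOddCode F) := by
  let A : Set ℕ := {i | t (2 ^ (2 * i + 1 + 1)) ≠ 0}
  have hA : ∀ N : ℕ, ∃ F, IsDecreasingSet d b F ∧ (∀ i ≤ N, i ∈ A ↔ i ∈ F) ∧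
      ∀ n : ℤ, |n| ≤ N → t n = blockSeq (evenOddCode F) n := by
    intro N
    obtain ⟨F, hF, hw⟩ := h (2 ^ (2 * N + 1 + 1))
    refine ⟨F, hF, fun i hi => ?_, fun n hn => hw n ?_⟩
    · have h1 : (2 : ℤ) ^ (2 * i + 1 + 1) ≤ 2 ^ (2 * N + 1 + 1) :=
        pow_le_pow_right₀ (by norm_num) (by omega)
      change t _ ≠ 0 ↔ _
      rw [hw _ (by rw [abs_of_pos (by positivity)]; exact_mod_cast h1), blockSeq_two_pow,
        odd_mem_evenOddCode]
    · have := natCast_lt_two_pow (2 * N + 1 + 1)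
      push_cast at this ⊢
      omega
  have hdec : ∀ i ∈ A, ∀ j ∈ A, i < j → d j < d i := by
    intro i hi j hj hij
    obtain ⟨F, hF, hiff, -⟩ := hA j
    exact hF.2 i ((hiff i hij.le).1 hi) j ((hiff j le_rfl).1 hj) hij
  -- An infinite set would give an infinite descending sequence of ordinals.
  have hfin : A.Finite := by
    by_contra hinf
    have hinf : A.Infinite := hinf
    let f := Nat.nth (· ∈ A)
    have hf : ∀ n, f n ∈ A := fun n => Nat.nth_mem_of_infinite hinf n
    have hlt : ∀ n, f n < f (n + 1) := fun n => Nat.nth_strictMono hinf (Nat.lt_succ_self n)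
    exact (WellFounded.not_rel_apply_succ (r := (· < ·)) fun n => d (f n)).elim
      fun n hn => hn (hdec _ (hf n) _ (hf (n + 1)) (hlt n))
  refine ⟨hfin.toFinset, ⟨fun i hi => ?_, fun i hi j hj => ?_⟩, funext fun n => ?_⟩
  · rw [Set.Finite.mem_toFinset] at hi
    obtain ⟨F, hF, hiff, -⟩ := hA i
    exact hF.1 i ((hiff i le_rfl).1 hi)
  · rw [Set.Finite.mem_toFinset] at hi hj
    exact hdec i hi j hj
  · obtain ⟨F, hF, hiff, hw⟩ := hA n.natAbs
    rw [hw n (by simp)]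
    exact blockSeq_evenOddCode_congr (N := n.natAbs)
      (fun i hi => by rw [Set.Finite.mem_toFinset, hiff i hi]) (by simp)

theorem exists_infinite_fibers (α : Type*) [Countable α] [Nonempty α] :
    ∃ f : ℕ → α, ∀ a, {i | f i = a}.Infinite := by
  obtain ⟨f, hf⟩ := exists_surjective_nat (α × ℕ)
  refine ⟨fun i => (f i).1, fun a hfin => ?_⟩
  refine Set.infinite_univ ((hfin.image fun i => (f i).2).subset fun n _ => ?_)
  obtain ⟨i, hi⟩ := hf (a, n)
  exact ⟨i, by simp [hi], by simp [hi]⟩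

theorem exists_enumeration_below {b : Ordinal.{0}} (hb : b.card ≤ ℵ₀) :
    ∃ d : ℕ → Ordinal.{0}, ∀ a < b, {i | d i = a}.Infinite := by
  -- `b + 1` instead of `b` keeps the interval nonempty when `b = 0`.
  have : Countable (Set.Iio (b + 1)) := by
    rw [← Cardinal.mk_le_aleph0_iff, Cardinal.mk_Iio_ordinal, lift_le_aleph0, Ordinal.card_add]
    simpa using hb
  have : Nonempty (Set.Iio (b + 1)) := ⟨⟨b, Set.mem_Iio.2 (Order.lt_add_one_iff.2 le_rfl)⟩⟩
  obtain ⟨f, hf⟩ := exists_infinite_fibers (Set.Iio (b + 1))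
  refine ⟨fun i => f i, fun a ha => (hf ⟨a, ha.trans (Order.lt_add_one_iff.2 le_rfl)⟩).mono ?_⟩
  intro i hi
  exact congrArg Subtype.val hi

theorem exists_isMinimalExample_add_three (b : Ordinal.{0}) (hb : b.card ≤ ℵ₀) :
    ∃ S : TwoSidedSubshift, S.IsMinimalExample (1 + b + 3) := by
  obtain ⟨d, hd⟩ := exists_enumeration_below hb
  let K := {F : Finset ℕ // IsDecreasingSet d b F}
  let empty : K := ⟨∅, by simp [IsDecreasingSet]⟩
  have : Nonempty K := ⟨empty⟩
  obtain ⟨g, hg⟩ := exists_infinite_fibers K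
  let G : ℕ → Set ℕ := fun i => evenOddCode (g i).1
  have hblock : ∀ F : K, IsTailLimit (blockConcat G) false (blockSeq (evenOddCode F.1)) := by
    intro F N
    obtain ⟨i, rfl, hi⟩ := (hg F).exists_gt N
    have := natCast_lt_four_pow i
    have hne : blockConcat G (16 * 4 ^ i) ≠ 0 := by rw [blockConcat_start]; decide
    exact ⟨16 * 4 ^ i, by omega, blockConcat_bodd hne, fun n hn => blockConcat_window (by omega)⟩
  have happrox : ∀ F : K, ∀ N : ℕ, ∀ n : ℤ, |n| ≤ N →
      blockSeq (evenOddCode F.1) (n + 2 ^ (2 * N + 1)) = singleSpike n :=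
    fun F N n hn => blockSeq_window even_mem_evenOddCode (by push_cast; omega)
  have hsingle : IsTailLimit (blockConcat G) false singleSpike :=
    .of_approx fun N => ⟨_, _, bodd_two_pow_succ (2 * N), hblock empty, happrox empty N⟩
  have hzero : IsTailLimit (blockConcat G) false 0 := by
    refine .of_approx fun N => ⟨_, _, bodd_two_mul (N + 1), hsingle, fun n hn => if_neg ?_⟩
    rw [abs_le] at hn
    omega
  let s : Option K → ℤ → Fin 3 := fun o => o.elim singleSpike fun F => blockSeq (evenOddCode F.1)
  -- Rank `0` is kept for the orbit, hence `1 +`. The value at `none`, the single spike, exceeds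
  -- every block rank, the largest being `1 + b` at the empty set.
  let ρ : Option K → Ordinal.{0} := fun o => o.elim (1 + b + 1) fun F => 1 + decreasingRank d b F.1
  have hlt : ∀ a : Ordinal.{0}, a < a + 1 := fun a => Order.lt_add_one_iff.2 le_rfl
  have hρlt : ∀ F : K, 1 + decreasingRank d b F.1 < 1 + b + 1 := fun F =>
    Order.lt_add_one_iff.2 (by gcongr; exact decreasingRank_le _)
  refine ⟨orbitClosure (blockConcat G), ?_⟩
  have h3 : 1 + b + 3 = 1 + b + 1 + 1 + 1 := by
    rw [show (3 : Ordinal.{0}) = 1 + 1 + 1 by norm_num, ← add_assoc, ← add_assoc]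
  rw [h3]
  refine orbitClosure_isMinimalExample_of_tailLimits (s := s) (ρ := ρ) (fun _ => blockConcat_of_neg)
    hzero ?_ ?_ ?_ ?_ ?_ ?_ ?_ ?_ ?_ ?_
  · rintro (_ | F) n hn
    · exact if_neg hn.ne
    · exact (blockSeq_of_ne hn.ne).trans (spikes_of_neg hn)
  · intro p t ht
    by_cases h2 : ∃ c, t c = 2
    · obtain ⟨c, hc⟩ := h2
      obtain ⟨hp, hw⟩ := ht.exists_block hc
      obtain ⟨F, hF, htF⟩ := exists_blockSeq_eq_of_forall_window (d := d) (b := b)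
        (t := fun n => t (n + c)) fun N => by
          obtain ⟨i, hi⟩ := hw N
          exact ⟨(g i).1, (g i).2, hi⟩
      refine Or.inr ⟨some ⟨F, hF⟩, -c, funext fun n => ?_, hp⟩
      have := congrFun htF (n + -c)
      rw [neg_add_cancel_right] at this
      exact this
    · push Not at h2
      by_cases h0 : t = 0
      · exact Or.inl h0
      · obtain ⟨u, hu⟩ := Function.ne_iff.1 h0
        exact Or.inr ⟨none, -u, ht.eq_singleSpike h2 hu⟩
  · rintro (_ | F)
    · exact hsingle
    · exact hblock F
  · rintro (_ | F)
    · refine ⟨0, ?_⟩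
      rintro (_ | F') k - hk
      · left
        have := hk 0 (by simp)
        simpa [s, singleSpike] using this
      · exact Or.inr (hρlt F')
    -- A window reaching the places of all odd codes up to `M` fixes the marker and the trace of
    -- `F'` below `M`. A different `F'` then adds an element beyond `M`, where `d` is smaller than
    -- on `F`, so its rank drops.
    · obtain ⟨M, hM⟩ := F.1.finite_toSet.bddAbove
      refine ⟨2 ^ (2 * M + 1 + 1), ?_⟩
      rintro (_ | F') k - hk
      · have h0 := hk 0 (by positivity)
        have h1 : singleSpike (0 + k) = 2 := h0.trans blockSeq_zero
        unfold singleSpike at h1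
        split_ifs at h1
        · exact absurd h1 (by decide)
        · exact absurd h1 (by decide)
      · have h0 := hk 0 (by positivity)
        obtain rfl : k = 0 := by
          have h1 : blockSeq (evenOddCode F'.1) (0 + k) = 2 := h0.trans blockSeq_zero
          rwa [blockSeq_eq_two, zero_add] at h1
        have hiff : ∀ i ≤ M, i ∈ F'.1 ↔ i ∈ F.1 := by
          intro i hi
          have h1 : (2 : ℤ) ^ (2 * i + 1 + 1) ≤ 2 ^ (2 * M + 1 + 1) :=
            pow_le_pow_right₀ (by norm_num) (by omega)
          have h2 : blockSeq (evenOddCode F'.1) (2 ^ (2 * i + 1 + 1) + 0) =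
              blockSeq (evenOddCode F.1) (2 ^ (2 * i + 1 + 1)) :=
            hk _ (by rw [abs_of_pos (by positivity)]; exact_mod_cast h1)
          rw [add_zero] at h2
          rw [← odd_mem_evenOddCode, ← odd_mem_evenOddCode, ← blockSeq_two_pow, ← blockSeq_two_pow,
            h2]
        by_cases hFF : F' = F
        · exact Or.inl ⟨congrArg some hFF, rfl⟩
        right
        have hsub : F.1 ⊆ F'.1 := fun i hi => (hiff i (hM hi)).2 hi
        obtain ⟨i, hi, hiF⟩ : ∃ i ∈ F'.1, i ∉ F.1 := by
          by_contra! h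
          exact hFF (Subtype.ext (Finset.Subset.antisymm h hsub))
        have hMi : M < i := by
          by_contra! hle
          exact hiF ((hiff i hle).1 hi)
        change 1 + decreasingRank d b F'.1 < 1 + decreasingRank d b F.1
        refine (add_lt_add_iff_left 1).2 ((decreasingRank_le_of_mem hi).trans_lt ?_)
        exact lt_decreasingRank (F'.2.1 i hi)
          fun j hj => F'.2.2 j (hsub hj) i hi ((hM hj).trans_lt hMi)
  · rintro (_ | F)
    · exact ⟨0, by simp [s, singleSpike]⟩
    · refine ⟨0, ?_⟩
      change blockSeq _ 0 ≠ 0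
      rw [blockSeq_zero]
      decide
  · rintro (_ | F)
    · exact le_self_add.trans (hlt _).le
    · exact le_self_add
  · rintro (_ | F)
    · exact hlt _
    · exact (hρlt F).trans (hlt _)
  · exact le_self_add.trans ((hlt _).trans (hlt _)).le
  · rintro (_ | F) a ha
    · refine Or.inr fun N => ⟨some empty, 2 ^ (2 * N + 1), bodd_two_pow_succ _,
        Or.inl (by simp), happrox empty N, ?_⟩
      change a ≤ 1 + decreasingRank d b ∅
      rw [decreasingRank_empty]
      exact Order.lt_add_one_iff.1 ha
    · by_cases h0 : a = 0
      · exact Or.inl h0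
      obtain ⟨c, rfl⟩ : ∃ c, a = 1 + c :=
        ⟨a - 1, (Ordinal.add_sub_cancel_of_le (Order.one_le_iff_ne_zero.2 h0)).symm⟩
      have hc : c < decreasingRank d b F.1 := (add_lt_add_iff_left 1).1 ha
      obtain ⟨M, hM⟩ := F.1.finite_toSet.bddAbove
      refine Or.inr fun N => ?_
      -- Each value of `d` below `b` is taken infinitely often: adding such a late `i` to `F` yields
      -- a decreasing set of rank at least `c` with the same window.
      obtain ⟨i, hi, hiM⟩ := (hd c (hc.trans_le (decreasingRank_le _))).exists_gt (N + M)
      have hi : d i = c := hi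
      have hlow : ∀ j ∈ F.1, c < d j := fun j hj => hc.trans_le (decreasingRank_le_of_mem hj)
      have hF' : IsDecreasingSet d b (insert i F.1) := by
        constructor
        · intro j hj
          rcases Finset.mem_insert.1 hj with rfl | hj
          · rw [hi]
            exact hc.trans_le (decreasingRank_le _)
          · exact F.2.1 j hj
        · intro j hj l hl hjl
          rcases Finset.mem_insert.1 hj with rfl | hj <;> rcases Finset.mem_insert.1 hl with rfl | hl
          · exact absurd hjl (lt_irrefl _)
          · have := hM hl
            omega
          · rw [hi]
            exact hlow _ ‹_›
          · exact F.2.2 j hj l hl hjl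
      refine ⟨some ⟨_, hF'⟩, 0, rfl, Or.inl fun h => ?_, fun n hn => ?_, ?_⟩
      · have h1 : insert i F.1 = F.1 := congrArg Subtype.val (Option.some_injective _ h)
        have h2 : i ∈ F.1 := by
          rw [← h1]
          exact Finset.mem_insert_self _ _
        have := hM h2
        omega
      · rw [add_zero]
        refine blockSeq_evenOddCode_congr (N := N) (fun j hj => ?_) hn
        rw [Finset.mem_insert, or_iff_right (by omega)]
      · refine add_le_add_right (le_decreasingRank (hc.le.trans (decreasingRank_le _)) ?_) 1
        intro j hj
        rcases Finset.mem_insert.1 hj with rfl | hj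
        · exact hi.ge
        · exact (hlow j hj).le
  · intro a ha
    exact Or.inr ⟨none, Order.lt_add_one_iff.1 ha⟩

end DecreasingSets

/-! ### Counting isomorphism classes -/

section Counting

theorem countableHomeoGraphs_subset : countableHomeoGraphs ⊆ homeoGraphs 2 := by
  rintro X ⟨hcount, hcomp, hmet, hf, h3⟩
  refine ⟨⟨hcomp, hmet, ?_⟩, hf, X.two_lt_ccn_iff.2 h3⟩
  let _ := TopologicalSpace.metrizableSpaceMetric X.V
  have : TotallyDisconnectedSpace X.V := ⟨Set.Countable.isTotallyDisconnected Set.countable_univ⟩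
  exact isTopologicalBasis_isClopen

/-- The closed set whose complement is the union of the sets `U n` with `n ∈ a`. -/
def codedClosed {E : Type} (U : ℕ → Set E) (a : Set ℕ) : Set E := (⋃ n ∈ a, U n)ᶜ

theorem exists_codedClosed {E : Type} [TopologicalSpace E] [SecondCountableTopology E] :
    ∃ U : ℕ → Set E, ∀ F : Set E, IsClosed F → ∃ a, codedClosed U a = F := by
  obtain ⟨b, hb, -, hbasis⟩ := TopologicalSpace.exists_countable_basis E
  obtain ⟨U, hU⟩ := (hb.insert ∅).exists_eq_range ⟨∅, Set.mem_insert _ _⟩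
  refine ⟨U, fun F hF => ⟨{n | U n ⊆ Fᶜ}, ?_⟩⟩
  rw [codedClosed, compl_eq_comm]
  refine Set.Subset.antisymm (fun x hx => ?_) (Set.iUnion₂_subset fun n hn => hn)
  obtain ⟨V, hV, hxV, hVF⟩ := hbasis.exists_subset_of_mem_open hx hF.isOpen_compl
  obtain ⟨n, rfl⟩ : V ∈ Set.range U := hU ▸ Set.mem_insert_of_mem _ hV
  exact Set.mem_iUnion₂.2 ⟨n, hVF, hxV⟩

theorem exists_continuous_injective_cantor {V : Type} [TopologicalSpace V] (h : IsZeroDimMetrizableCompact V) :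
    ∃ φ : V → ℕ → Bool, Continuous φ ∧ Function.Injective φ := by
  have := h.compact
  have := h.metrizable
  let _ := TopologicalSpace.metrizableSpaceMetric V
  obtain ⟨b, hb, hcount, hbasis⟩ := h.zeroDim.exists_countable
  obtain ⟨U, hU⟩ := (hcount.insert ∅).exists_eq_range ⟨∅, Set.mem_insert _ _⟩
  have hclopen : ∀ n, IsClopen (U n) := by
    intro n
    have : U n ∈ insert ∅ b := hU ▸ Set.mem_range_self n
    rcases this with h | h
    · rw [h]
      exact isClopen_empty
    · exact hb h
  refine ⟨fun x n => (U n).boolIndicator x, continuous_pi fun n => ?_, fun x y hxy => ?_⟩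
  · exact (continuous_boolIndicator_iff_isClopen _).2 (hclopen n)
  · by_contra hne
    obtain ⟨V, hV, hxV, hyV⟩ := hbasis.exists_subset_of_mem_open (a := x) (u := {y}ᶜ) hne
      isOpen_compl_singleton
    obtain ⟨n, rfl⟩ : V ∈ Set.range U := hU ▸ Set.mem_insert_of_mem _ hV
    have h1 : (U n).boolIndicator x = (U n).boolIndicator y := congrFun hxy n
    rw [Set.mem_iff_boolIndicator, h1, ← Set.mem_iff_boolIndicator] at hxV
    exact hyV hxV rfl

/-- The graph on a subset of the Cantor space generated by a relation. -/
def subsetGraph (F : Set (ℕ → Bool)) (R : Set ((ℕ → Bool) × (ℕ → Bool))) : TopGraph where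
  V := F
  graph := SimpleGraph.fromRel fun x y => (x.1, y.1) ∈ R

/-- The space embeds in the Cantor space, and the graph of the homeomorphism becomes a compact
relation; fixed points are harmless because `SimpleGraph.fromRel` discards the diagonal. -/
theorem exists_iso_subsetGraph {X : TopGraph} (hX : X ∈ homeoGraphs 2) :
    ∃ F R, IsClosed F ∧ IsClosed R ∧ TopGraph.isoSetoid.r X (subsetGraph F R) := by
  obtain ⟨hV, ⟨f, hf⟩, -⟩ := hX
  have := hV.compact
  have := hV.metrizable
  obtain ⟨φ, hφ, iφ⟩ := exists_continuous_injective_cantor hV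
  have hemb : Topology.IsEmbedding φ := (hφ.isClosedEmbedding iφ).isEmbedding
  refine ⟨Set.range φ, Set.range fun x => (φ x, φ (f x)), (isCompact_range hφ).isClosed,
    (isCompact_range (hφ.prodMk (hφ.comp f.continuous))).isClosed, hemb.toHomeomorph, fun x y => ?_⟩
  have key : ∀ x y, (φ x, φ y) ∈ (Set.range fun x => (φ x, φ (f x))) ↔ f x = y := by
    intro x y
    constructor
    · rintro ⟨z, hz⟩
      obtain ⟨h1, h2⟩ := Prod.ext_iff.1 hz
      rw [← iφ h1]
      exact iφ h2
    · rintro rfl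
      exact ⟨x, rfl⟩
  rw [hf, inducedGraph_adj]
  refine Iff.trans ?_ (SimpleGraph.fromRel_adj _ _ _).symm
  exact and_congr hemb.toHomeomorph.injective.ne_iff.symm
    (or_congr (key x y).symm (key y x).symm)

theorem mk_isoClasses_le (B : Set TopGraph) (hB : B ⊆ homeoGraphs 2) :
    #(Quotient.mk TopGraph.isoSetoid '' B) ≤ 𝔠 := by
  obtain ⟨U, hU⟩ := exists_codedClosed (E := ℕ → Bool)
  obtain ⟨W, hW⟩ := exists_codedClosed (E := (ℕ → Bool) × (ℕ → Bool))
  let T : Set ℕ × Set ℕ → Quotient TopGraph.isoSetoid :=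
    fun p => Quotient.mk _ (subsetGraph (codedClosed U p.1) (codedClosed W p.2))
  have hsub : Quotient.mk TopGraph.isoSetoid '' B ⊆ Set.range T := by
    rintro _ ⟨X, hX, rfl⟩
    obtain ⟨F, R, hF, hR, hiso⟩ := exists_iso_subsetGraph (hB hX)
    obtain ⟨a, rfl⟩ := hU F hF
    obtain ⟨c, rfl⟩ := hW R hR
    exact ⟨(a, c), (Quotient.sound hiso).symm⟩
  refine (mk_le_mk_of_subset hsub).trans ?_
  have h1 : lift.{0} #(Set.range T) ≤ lift.{1} #(Set ℕ × Set ℕ) := mk_range_le_lift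
  rw [lift_uzero] at h1
  refine h1.trans ?_
  simp

end Counting

/-! ### Lower bound for bases, and assembly -/

theorem continuum_le_isoClasses {S : (ℕ → Bool) → TwoSidedSubshift} {ξ : Ordinal.{0}}
    (hS : ∀ α, (S α).IsMinimalExample ξ)
    (hanti : ∀ α β, α ≠ β → ¬ (S α).shiftGraph ≤ (S β).shiftGraph) {B : Set TopGraph}
    (hB : B ⊆ homeoGraphs 2) (hbelow : ∀ α, ∃ Y ∈ B, Y ≤ (S α).shiftGraph) :
    𝔠 ≤ #(Quotient.mk TopGraph.isoSetoid '' B) := by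
  choose Y hYB hY using hbelow
  have hinj : Function.Injective fun α =>
      (⟨Quotient.mk _ (Y α), Y α, hYB α, rfl⟩ : Quotient.mk TopGraph.isoSetoid '' B) := by
    intro α β h
    obtain ⟨e, he⟩ : TopGraph.isoSetoid.r (Y α) (Y β) := Quotient.exact (congrArg Subtype.val h)
    have h1 : Y α ≤ Y β := ⟨e, e.continuous, e.injective, fun x y => (he x y).1⟩
    by_contra hne
    -- By minimality `S α` is below `Y α`, so an isomorphism of `Y α` with `Y β` would put `S α`
    -- below `S β`.
    exact hanti α β hne ((((hS α).minimal_homeo.2 (hB (hYB α)) (hY α)).trans h1).trans (hY β))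
  have h1 := lift_mk_le'.2 ⟨⟨_, hinj⟩⟩
  rw [lift_uzero] at h1
  refine le_trans ?_ h1
  simp

theorem TwoSidedSubshift.IsMinimalExample.mem_countableHomeoGraphs {S : TwoSidedSubshift}
    {ξ : Ordinal.{0}} (h : S.IsMinimalExample ξ) : S.shiftGraph ∈ countableHomeoGraphs :=
  ⟨h.countable, h.minimal_closed.1.1.compact, h.minimal_closed.1.1.metrizable,
    h.minimal_homeo.1.2.1, h.minimal_closed.1.2.2⟩

theorem exists_isMinimalExample {ξ : Ordinal.{0}} (h1 : 1 ≤ ξ) (hcard : ξ.card ≤ ℵ₀)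
    (hξ : ξ < Ordinal.omega0 ∨ ∃ η : Ordinal.{0}, ξ = η + 3) :
    ∃ S : TwoSidedSubshift, S.IsMinimalExample ξ := by
  have hthree : ∀ η : Ordinal.{0}, (η + 3).card ≤ ℵ₀ →
      ∃ S : TwoSidedSubshift, S.IsMinimalExample (η + 3) := by
    intro η hη
    -- The block construction needs `η` of the form `1 + b`; the spikes cover `η = 0`.
    by_cases h0 : η = 0
    · rw [h0, zero_add]
      exact ⟨_, orbitClosure_spikes_isMinimalExample Set.infinite_univ⟩
    · obtain ⟨b, rfl⟩ : ∃ b, η = 1 + b :=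
        ⟨η - 1, (Ordinal.add_sub_cancel_of_le (Order.one_le_iff_ne_zero.2 h0)).symm⟩
      refine exists_isMinimalExample_add_three b (le_trans (Ordinal.card_le_card ?_) hη)
      exact le_add_self.trans le_self_add
  rcases hξ with hω | ⟨η, rfl⟩
  · obtain ⟨n, rfl⟩ := Ordinal.lt_omega0.1 hω
    match n with
    | 0 => simp at h1
    | 1 => exact ⟨_, by simpa using triangleSubshift_isMinimalExample⟩
    | 2 => exact ⟨_, by simpa using orbitClosure_zero_isMinimalExample⟩
    | m + 3 =>
      rw [Nat.cast_add] at hcard ⊢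
      exact hthree m hcard
  · exact hthree η hcard

theorem theorem1p15 :
    -- (a) examples of every countable rank which is finite or of the form `η + 3`
    (∀ ξ : Ordinal.{0}, 1 ≤ ξ → ξ.card ≤ ℵ₀ → (ξ < Ordinal.omega0 ∨ ∃ η : Ordinal.{0}, ξ = η + 3) →
      ∃ S : TwoSidedSubshift, S.IsMinimalExample ξ) ∧
    -- (b) a continuum-sized antichain of examples of rank three
    (∃ S : (ℕ → Bool) → TwoSidedSubshift,
      (∀ α, (S α).IsMinimalExample 3) ∧
      ∀ α β, α ≠ β → ¬ (S α).shiftGraph ≤ (S β).shiftGraph) ∧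
    -- the size of a basis, also when isomorphic graphs are identified
    (∀ B : Set TopGraph, IsGraphBasis B (homeoGraphs 2) ∨ IsGraphBasis B countableHomeoGraphs →
      𝔠 ≤ #B ∧ #(Quotient.mk TopGraph.isoSetoid '' B) = 𝔠) := by

  have hS : ∀ α, (orbitClosure (spikes (branchCodes α))).IsMinimalExample 3 :=
    fun α => orbitClosure_spikes_isMinimalExample (branchCodes_infinite α)
  refine ⟨fun ξ => exists_isMinimalExample,
    ⟨_, hS, fun α β => orbitClosure_branchCodes_not_le⟩, fun B hB => ?_⟩
  have hsub : B ⊆ homeoGraphs 2 := by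
    rcases hB with hB | hB
    · exact hB.1
    · exact hB.1.trans countableHomeoGraphs_subset
  have hbelow : ∀ α, ∃ Y ∈ B, Y ≤ (orbitClosure (spikes (branchCodes α))).shiftGraph := by
    intro α
    rcases hB with hB | hB
    · exact hB.2 _ (hS α).minimal_homeo.1
    · exact hB.2 _ (hS α).mem_countableHomeoGraphs
  have hge := continuum_le_isoClasses hS (fun α β => orbitClosure_branchCodes_not_le) hsub hbelow
  exact ⟨hge.trans mk_image_le, le_antisymm (mk_isoClasses_le B hsub) hge⟩
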